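/- **Setting.** Fix a universe of schemes. For a scheme $X$, the big Zariski site $\mathrm{Zar}(X)$ is the category of all schemes over $X$ with jointly surjective families of open immersions as coverings; write $\mathcal O(Y)=\Gamma(Y,\mathcal O_Y)$. For a sieve $H$ on $X$ containing a Zariski covering of $X$, let $\mathcal C_H$ be the full subcategory of schemes over $X$ whose structure map is in $H$. An $H$-presheaf is a presheaf $E$ on $\mathcal C_H$ with an $\mathcal O(Y)$-module $E(Y)$ for every $Y$ in $\mathcal C_H$ and semilinear restriction maps. Its sheafification $\xi_HE$ is a sheaf of modules on $\mathrm{Zar}(X)$: identifying locally equal sections gives $E^s$, and elements of $(\xi_HE)(U)$ are represented by families of compatible sections of $E^s$ on coverings $\{U_i\to U\}$ by objects $U_i$ of $\mathcal C_H$, two families being identified if they agree on a common refinement. A *standard vector bundle* on $X$ is a pair $(H,E)$ with $H$ as above and $E$ an $H$-presheaf such that each $E(Y)$ is a standard free module $\mathcal O(Y)^n$ (the number $n$ is part of the data and may depend on $Y$) and such that, for each $f:Y\to X$ in $\mathcal C_H$, the map from $Z\mapsto \mathcal O(Z)^n$ to $f^*E$ on $\mathrm{Zar}(Y)$ induced by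 the standard basis of $E(Y)$ is an isomorphism; here $(f^*E)(Z\to Y)=E(Z\to Y\to X)$. It is a *standard line bundle* if $n=1$ for every $Y$. Morphisms $(H,E)\to(K,F)$ are the morphisms of sheaves of modules $\xi_HE\to\xi_KF$. This gives a category $BV(X)$ and the full subcategory $BL(X)$ of standard line bundles. The trivial standard line bundle $\mathcal O_X$ is $Y\mapsto\mathcal O(Y)^1$ on the maximal sieve. For $(H,E)$ and $(K,F)$ in $BV(X)$, the *tensor product* $E\otimes F$ is the standard vector bundle on $H\cap K$ that is obtained from $Y\mapsto E(Y)\otimes_{\mathcal O(Y)}F(Y)$ by transport along the isomorphisms $$\mathcal O(Y)^r\otimes \mathcal O(Y)^s\to\mathcal O(Y)^{rs},\qquad (a_1,\dots,a_r)\otimes(b_1,\dots,b_s)\mapsto(a_1b_1,\dots,a_1b_s,\dots,a_rb_1,\dots,a_rb_s).$$ Write $\underline\otimes$ for the presheaf tensor product, $\xi$ for sheafification on $\mathrm{Zar}(X)$, and $\zeta_{E,F}:\xi_{H\cap K}(E\otimes F)\cong\xi(\xi_HE\,\underline\otimes\,\xi_KF)$ for the canonical isomorphism. For morphisms $\gamma:(H,E)\to(H',E')$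 and $\delta:(K,F)\to(K',F')$, one puts $\gamma\otimes\delta=\zeta_{E',F'}^{-1}\circ\xi(\gamma\,\underline\otimes\,\delta)\circ\zeta_{E,F}$. This defines a bifunctor $\otimes:BV(X)\times BV(X)\to BV(X)$. A map of schemes $f:Y\to X$ defines a functor $f^*:BV(X)\to BV(Y)$, $(H,E)\mapsto(f^*H,f^*E)$, where $f^*H$ consists of the $g$ with $f g\in H$, $(f^*E)(g)=E(fg)$, and morphisms are pulled back in the same way, using $f^*\xi_HE=\xi_{f^*H}f^*E$. **Theorem.** Let $X$ be a scheme. All of the following are strict equalities (not only natural isomorphisms), of objects and of morphisms. 1. The tensor product is strictly associative: $\otimes\circ(\otimes\times 1)=\otimes\circ(1\times\otimes)$ as functors $BV(X)\times BV(X)\times BV(X)\to BV(X)$. 2. $\mathcal O_X$ is a strict unit: $\mathcal O_X\otimes E=E\otimes\mathcal O_X=E$ for every $E$ in $BV(X)$, and $1_{\mathcal O_X}\otimes\gamma=\gamma\otimes 1_{\mathcal O_X}=\gamma$ for every morphism $\gamma$ of $BV(X)$. 3. $BL(X)$ is a strict center: $E\otimes L=L\otimes E$ for all $E\in BV(X)$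 and $L\in BL(X)$, and $\gamma\otimes\beta=\beta\otimes\gamma$ for all morphisms $\gamma$ of $BV(X)$ and $\beta$ of $BL(X)$. 4. For every map of schemes $f:Y\to X$, one has $f^*\mathcal O_X=\mathcal O_Y$, and $f^*\circ\otimes=\otimes\circ(f^*\times f^*)$ as functors $BV(X)\times BV(X)\to BV(Y)$. -/

import Mathlib

open CategoryTheory AlgebraicGeometry

universe u v w x v' w'

namespace StdBundle

section Presheaves

variable {X : Scheme.{u}}

/-- The category of a sieve `H` on `X`: the full subcategory of the category `Over X` of schemes
over `X` (the big Zariski site of `X`) on the structure morphisms that belong to `H`. For `H = ⊤` it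
is the whole big Zariski site. (A sieve on the final object of `Over X` is the same thing as a sieve
on `X` in the category of schemes.) -/
abbrev Dom (H : Sieve X) := H.arrows.category

/-- The big structure sheaf: `U ↦ Γ(U, O_U)`. -/
abbrev O (U : Over X) : Type u := Γ(U.left, ⊤)

/-- The restriction maps of the big structure sheaf. -/
def resO {V U : Over X} (g : V ⟶ U) : O U →+* O V := g.left.appTop.hom

lemma resO_id (U : Over X) (r : O U) : resO (𝟙 U) r = r := by
  simp [resO]

lemma resO_comp {W V U : Over X} (h : W ⟶ V) (g : V ⟶ U) (r : O U) :
    resO (h ≫ g) r = resO h (resO g r) := by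
  change (h.left ≫ g.left).appTop.hom r = _
  rw [Scheme.Hom.comp_appTop]
  rfl

/-- An `H`-presheaf of modules over the big structure sheaf: a contravariant functor on the category
of the sieve `H` with an `O U`-module over each `U` and semilinear restriction maps. It is spelled
out, rather than taken from `PresheafOfModules`, so that modules over the same ring may live in
different universes: sheafification on the big site raises the universe. -/
structure ModPresheaf (H : Sieve X) where
  obj : Dom H → Type v
  [addCommGroup : ∀ U, AddCommGroup (obj U)]
  [module : ∀ U, Module (O U.obj) (obj U)]
  res : ∀ {V U : Dom H} (g : V ⟶ U), obj U →ₛₗ[resO g.hom] obj V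
  res_id : ∀ (U : Dom H) (s : obj U), res (𝟙 U) s = s
  res_comp : ∀ {W V U : Dom H} (h : W ⟶ V) (g : V ⟶ U) (s : obj U),
    res (h ≫ g) s = res h (res g s)

attribute [instance] ModPresheaf.addCommGroup ModPresheaf.module

namespace ModPresheaf

variable {H K : Sieve X}

/-- Morphisms of `H`-presheaves of modules: natural transformations that are linear on sections.
Morphisms of sheaves of modules are the same thing. -/
@[ext]
structure Hom (F : ModPresheaf.{u, v} H) (G : ModPresheaf.{u, w} H) where
  app : ∀ U, F.obj U →ₗ[O U.obj] G.obj U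
  naturality : ∀ {V U : Dom H} (g : V ⟶ U) (s : F.obj U), app V (F.res g s) = G.res g (app U s)

lemma res_congr (F : ModPresheaf.{u, v} H) {V U : Dom H} {g g' : V ⟶ U} (h : g = g')
    (s : F.obj U) : F.res g s = F.res g' s := by
  rw [h]

/-- The sections over `U` that are locally zero, that is, that vanish after restriction to a covering.
The separated presheaf `F^s` is `U ↦ F(U)` modulo these: two sections are identified in `F^s(U)` iff
their difference is locally zero. A covering of `U` is given through the covering sieve that it
generates, for the Zariski topology on schemes. -/
def locallyZero (F : ModPresheaf.{u, v} H) (U : Dom H) : Submodule (O U.obj) (F.obj U) where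
  carrier := {s | ∃ S : Sieve U.obj.left, S ∈ Scheme.zariskiTopology U.obj.left ∧
    ∀ (V : Dom H) (g : V ⟶ U), S g.hom.left → F.res g s = 0}
  zero_mem' := ⟨⊤, Scheme.zariskiTopology.top_mem _, fun V g _ => map_zero _⟩
  add_mem' := by
    rintro s t ⟨S, hS, hs⟩ ⟨T, hT, ht⟩
    refine ⟨S ⊓ T, Scheme.zariskiTopology.intersection_covering hS hT, fun V g h => ?_⟩
    rw [map_add, hs V g h.1, ht V g h.2, add_zero]
  smul_mem' := by
    rintro r s ⟨S, hS, hs⟩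
    exact ⟨S, hS, fun V g h => by rw [map_smulₛₗ, hs V g h, smul_zero]⟩

/-- All families of sections `s W k ∈ F(W)`, over the morphisms `k : W ⟶ U` with `W` in the category
of the sieve `H`. -/
def Fam (F : ModPresheaf.{u, v} H) (U : Over X) : Type (max v (u + 1)) :=
  ∀ W : Dom H, (W.obj ⟶ U) → F.obj W

instance (F : ModPresheaf.{u, v} H) (U : Over X) : AddCommGroup (F.Fam U) :=
  inferInstanceAs (AddCommGroup (∀ W : Dom H, (W.obj ⟶ U) → F.obj W))

instance (F : ModPresheaf.{u, v} H) (U : Over X) : Module (O U) (F.Fam U) where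
  smul r s := fun W k => resO k r • s W k
  one_smul s := by funext W k; exact (congrArg (· • s W k) (map_one _)).trans (one_smul _ _)
  mul_smul a b s := by funext W k; exact (congrArg (· • s W k) (map_mul _ _ _)).trans (mul_smul _ _ _)
  smul_zero a := by funext W k; exact smul_zero _
  smul_add a s t := by funext W k; exact smul_add _ _ _
  add_smul a b s := by funext W k; exact (congrArg (· • s W k) (map_add _ _ _)).trans (add_smul _ _ _)
  zero_smul s := by funext W k; exact (congrArg (· • s W k) (map_zero _)).trans (zero_smul _ _)

lemma Fam.smul_apply {F : ModPresheaf.{u, v} H} {U : Over X} (r : O U) (s : F.Fam U) (W : Dom H)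
    (k : W.obj ⟶ U) : (r • s) W k = resO k r • s W k := rfl

/-- The families that are compatible sections of `F^s` on some covering: there is a covering sieve `S`
of `U` such that for `k : V ⟶ U` in `S` and `g : W ⟶ V`, the sections `s W (g ≫ k)` and `(s V k)|_W`
agree in `F^s(W)`. The values of the family outside of `S` are irrelevant. -/
def matching (F : ModPresheaf.{u, v} H) (U : Over X) : Submodule (O U) (F.Fam U) where
  carrier := {s | ∃ S : Sieve U.left, S ∈ Scheme.zariskiTopology U.left ∧
    ∀ (V : Dom H) (k : V.obj ⟶ U), S k.left → ∀ (W : Dom H) (g : W ⟶ V),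
      s W (g.hom ≫ k) - F.res g (s V k) ∈ F.locallyZero W}
  zero_mem' := ⟨⊤, Scheme.zariskiTopology.top_mem _, fun V k _ W g => by
    have : (0 : F.Fam U) W (g.hom ≫ k) - F.res g ((0 : F.Fam U) V k) = 0 := by
      change (0 : F.obj W) - F.res g 0 = 0
      simp
    rw [this]; exact zero_mem _⟩
  add_mem' := by
    rintro s t ⟨S, hS, hs⟩ ⟨T, hT, ht⟩
    refine ⟨S ⊓ T, Scheme.zariskiTopology.intersection_covering hS hT, fun V k h W g => ?_⟩
    have := add_mem (hs V k h.1 W g) (ht V k h.2 W g)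
    convert! this using 1
    change (s W _ + t W _) - F.res g (s V k + t V k) = _
    rw [map_add]; abel
  smul_mem' := by
    rintro r s ⟨S, hS, hs⟩
    refine ⟨S, hS, fun V k h W g => ?_⟩
    have := (F.locallyZero W).smul_mem (resO (g.hom ≫ k) r) (hs V k h W g)
    convert! this using 1
    rw [Fam.smul_apply, Fam.smul_apply, map_smulₛₗ, resO_comp, smul_sub]

/-- The families that are zero as sections of `F^s` on some covering sieve of `U`. -/
def vanishing (F : ModPresheaf.{u, v} H) (U : Over X) : Submodule (O U) (F.Fam U) where
  carrier := {s | ∃ S : Sieve U.left, S ∈ Scheme.zariskiTopology U.left ∧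
    ∀ (V : Dom H) (k : V.obj ⟶ U), S k.left → s V k ∈ F.locallyZero V}
  zero_mem' := ⟨⊤, Scheme.zariskiTopology.top_mem _, fun V k _ => (F.locallyZero V).zero_mem⟩
  add_mem' := by
    rintro s t ⟨S, hS, hs⟩ ⟨T, hT, ht⟩
    exact ⟨S ⊓ T, Scheme.zariskiTopology.intersection_covering hS hT,
      fun V k h => add_mem (hs V k h.1) (ht V k h.2)⟩
  smul_mem' := by
    rintro r s ⟨S, hS, hs⟩
    exact ⟨S, hS, fun V k h => Submodule.smul_mem _ _ (hs V k h)⟩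

/-- Sections over `U` of the sheafification: classes of families of sections of `F^s` that are
defined and compatible on a covering of `U` by objects of the category of `H`, two of them being
identified when they agree on a common refinement. -/
abbrev ShObj (F : ModPresheaf.{u, v} H) (U : Over X) : Type (max v (u + 1)) :=
  F.matching U ⧸ (F.vanishing U).submoduleOf (F.matching U)

/-- Restriction of families along `f : V ⟶ U`: pull back the covering. -/
def famRes (F : ModPresheaf.{u, v} H) {V U : Over X} (f : V ⟶ U) :
    F.Fam U →ₛₗ[resO f] F.Fam V where
  toFun s := fun W k => s W (k ≫ f)
  map_add' _ _ := rfl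
  map_smul' r s := by
    funext W k
    change resO (k ≫ f) r • s W (k ≫ f) = resO k (resO f r) • s W (k ≫ f)
    rw [resO_comp]

lemma famRes_mem_matching (F : ModPresheaf.{u, v} H) {V U : Over X} (f : V ⟶ U) {s : F.Fam U}
    (hs : s ∈ F.matching U) : F.famRes f s ∈ F.matching V := by
  obtain ⟨S, hS, h⟩ := hs
  refine ⟨S.pullback f.left, Scheme.zariskiTopology.pullback_stable _ hS, fun V k hk W g => ?_⟩
  have := h V (k ≫ f) hk W g
  rwa [← Category.assoc] at this

lemma famRes_mem_vanishing (F : ModPresheaf.{u, v} H) {V U : Over X} (f : V ⟶ U) {s : F.Fam U}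
    (hs : s ∈ F.vanishing U) : F.famRes f s ∈ F.vanishing V := by
  obtain ⟨S, hS, h⟩ := hs
  exact ⟨S.pullback f.left, Scheme.zariskiTopology.pullback_stable _ hS,
    fun V k hk => h V (k ≫ f) hk⟩

/-- A semilinear map that respects submodules descends to the subquotients. -/
def descend {R R' : Type u} {M : Type v} {M' : Type w} [CommRing R] [CommRing R']
    [AddCommGroup M] [AddCommGroup M'] [Module R M] [Module R' M'] {σ : R →+* R'}
    (φ : M →ₛₗ[σ] M') (A N : Submodule R M) (A' N' : Submodule R' M')
    (hA : ∀ s ∈ A, φ s ∈ A') (hN : ∀ s ∈ N, φ s ∈ N') :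
    (A ⧸ N.submoduleOf A) →ₛₗ[σ] (A' ⧸ N'.submoduleOf A') :=
  Submodule.mapQ _ _ (φ.restrict hA) (fun s hs => hN s hs)

/-- The sheafification functor from `H`-presheaves to sheaves on the big Zariski site of `X`, on objects.
For an arbitrary sieve it is defined by the same formula; it is used for covering sieves. -/
def sheafify (F : ModPresheaf.{u, v} H) : ModPresheaf.{u, max v (u + 1)} (⊤ : Sieve X) where
  obj U := F.ShObj U.obj
  res f := descend (F.famRes f.hom) _ _ _ _ (fun _ => F.famRes_mem_matching f.hom)
    (fun _ => F.famRes_mem_vanishing f.hom)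
  res_id U s := by
    obtain ⟨s, rfl⟩ := Submodule.Quotient.mk_surjective _ s
    refine congrArg Submodule.Quotient.mk (Subtype.ext ?_)
    funext W k
    change s.1 W (k ≫ 𝟙 _) = _
    rw [Category.comp_id]
  res_comp h g s := by
    obtain ⟨s, rfl⟩ := Submodule.Quotient.mk_surjective _ s
    refine congrArg Submodule.Quotient.mk (Subtype.ext ?_)
    funext W k
    change s.1 W (k ≫ h.hom ≫ g.hom) = s.1 W ((k ≫ h.hom) ≫ g.hom)
    rw [Category.assoc]


/-- The class of a compatible family. -/
def cls (F : ModPresheaf.{u, v} H) (U : Dom (⊤ : Sieve X)) (s : F.Fam U.obj)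
    (hs : s ∈ F.matching U.obj) : F.sheafify.obj U :=
  Submodule.Quotient.mk (p := (F.vanishing U.obj).submoduleOf (F.matching U.obj)) ⟨s, hs⟩

lemma cls_eq_cls (F : ModPresheaf.{u, v} H) {U : Dom (⊤ : Sieve X)} {s t : F.Fam U.obj}
    (hs : s ∈ F.matching U.obj) (ht : t ∈ F.matching U.obj) :
    F.cls U s hs = F.cls U t ht ↔ s - t ∈ F.vanishing U.obj :=
  Submodule.Quotient.eq ((F.vanishing U.obj).submoduleOf (F.matching U.obj))

lemma cls_eq_zero (F : ModPresheaf.{u, v} H) {U : Dom (⊤ : Sieve X)} {s : F.Fam U.obj}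
    (hs : s ∈ F.matching U.obj) : F.cls U s hs = 0 ↔ s ∈ F.vanishing U.obj :=
  Submodule.Quotient.mk_eq_zero ((F.vanishing U.obj).submoduleOf (F.matching U.obj))

lemma exists_cls (F : ModPresheaf.{u, v} H) (U : Dom (⊤ : Sieve X)) (x : F.sheafify.obj U) :
    ∃ s hs, F.cls U s hs = x := by
  obtain ⟨⟨s, hs⟩, h⟩ := Submodule.Quotient.mk_surjective _ x
  exact ⟨s, hs, h⟩

section Homs

namespace Hom

variable {H : Sieve X}

/-- The identity morphism. -/
def id (F : ModPresheaf.{u, v} H) : Hom F F where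
  app _ := LinearMap.id
  naturality _ _ := rfl

/-- Composition of morphisms, in diagrammatic order. -/
def comp {F : ModPresheaf.{u, v} H} {G : ModPresheaf.{u, w} H} {L : ModPresheaf.{u, x} H}
    (α : Hom F G) (β : Hom G L) : Hom F L where
  app U := β.app U ∘ₗ α.app U
  naturality g s := by
    simp only [LinearMap.comp_apply, α.naturality, β.naturality]

end Hom

/-- Isomorphisms of `H`-presheaves of modules. -/
structure Equiv (F : ModPresheaf.{u, v} H) (G : ModPresheaf.{u, w} H) where
  app : ∀ U, F.obj U ≃ₗ[O U.obj] G.obj U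
  naturality : ∀ {V U : Dom H} (g : V ⟶ U) (s : F.obj U), app V (F.res g s) = G.res g (app U s)

namespace Equiv

variable {F : ModPresheaf.{u, v} H} {G : ModPresheaf.{u, w} H} {L : ModPresheaf.{u, x} H}

/-- The underlying morphism. -/
def toHom (e : Equiv F G) : Hom F G where
  app U := (e.app U).toLinearMap
  naturality := e.naturality

/-- The inverse isomorphism. -/
def symm (e : Equiv F G) : Equiv G F where
  app U := (e.app U).symm
  naturality g s := by
    rw [LinearEquiv.symm_apply_eq, e.naturality, LinearEquiv.apply_symm_apply]

/-- Composition of isomorphisms. -/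
def trans (e : Equiv F G) (e' : Equiv G L) : Equiv F L where
  app U := (e.app U).trans (e'.app U)
  naturality g s := by
    simp only [LinearEquiv.trans_apply, e.naturality, e'.naturality]

/-- A morphism that is bijective on sections is an isomorphism. -/
noncomputable def ofBijective (α : Hom F G) (h : ∀ U, Function.Bijective (α.app U)) : Equiv F G where
  app U := LinearEquiv.ofBijective (α.app U) (h U)
  naturality g s := α.naturality g s

lemma toHom_comp_symm (e : Equiv F G) : e.toHom.comp e.symm.toHom = Hom.id F := by
  ext U s
  exact (e.app U).symm_apply_apply s

lemma symm_comp_toHom (e : Equiv F G) : e.symm.toHom.comp e.toHom = Hom.id G := by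
  ext U s
  exact (e.app U).apply_symm_apply s

end Equiv

variable {F : ModPresheaf.{u, v} H} {G : ModPresheaf.{u, w} H} {L : ModPresheaf.{u, x} H}

/-- A morphism of presheaves acts on families. -/
def famMap (γ : Hom F G) (U : Over X) : F.Fam U →ₗ[O U] G.Fam U where
  toFun s := fun W k => γ.app W (s W k)
  map_add' s t := by funext W k; exact map_add _ _ _
  map_smul' r s := by funext W k; exact map_smul _ _ _

lemma map_mem_locallyZero (γ : Hom F G) {U : Dom H} {s : F.obj U} (hs : s ∈ F.locallyZero U) :
    γ.app U s ∈ G.locallyZero U := by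
  obtain ⟨S, hS, h⟩ := hs
  exact ⟨S, hS, fun V g hg => by rw [← γ.naturality, h V g hg, map_zero]⟩

lemma famMap_mem_matching (γ : Hom F G) (U : Over X) {s : F.Fam U} (hs : s ∈ F.matching U) :
    famMap γ U s ∈ G.matching U := by
  obtain ⟨S, hS, h⟩ := hs
  refine ⟨S, hS, fun V k hk W g => ?_⟩
  have := map_mem_locallyZero γ (h V k hk W g)
  rwa [map_sub, γ.naturality] at this

lemma famMap_mem_vanishing (γ : Hom F G) (U : Over X) {s : F.Fam U} (hs : s ∈ F.vanishing U) :
    famMap γ U s ∈ G.vanishing U := by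
  obtain ⟨S, hS, h⟩ := hs
  exact ⟨S, hS, fun V k hk => map_mem_locallyZero γ (h V k hk)⟩

/-- The sheafification functor on morphisms. -/
def sheafifyMap (γ : Hom F G) : Hom F.sheafify G.sheafify where
  app U := descend (famMap γ U.obj) _ _ _ _ (fun _ => famMap_mem_matching γ U.obj)
    (fun _ => famMap_mem_vanishing γ U.obj)
  naturality g s := by
    obtain ⟨s, rfl⟩ := Submodule.Quotient.mk_surjective _ s
    rfl

lemma sheafifyMap_id (F : ModPresheaf.{u, v} H) : sheafifyMap (Hom.id F) = Hom.id F.sheafify := by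
  ext U s
  obtain ⟨s, rfl⟩ := Submodule.Quotient.mk_surjective _ s
  rfl

lemma sheafifyMap_comp (α : Hom F G) (β : Hom G L) :
    sheafifyMap (α.comp β) = (sheafifyMap α).comp (sheafifyMap β) := by
  ext U s
  obtain ⟨s, rfl⟩ := Submodule.Quotient.mk_surjective _ s
  rfl

/-- Sheafification of an isomorphism. -/
def sheafifyEquiv (e : Equiv F G) : Equiv F.sheafify G.sheafify where
  app U := LinearEquiv.ofLinearMap ((sheafifyMap e.toHom).app U) ((sheafifyMap e.symm.toHom).app U)
    (by
      have := congrArg (fun γ => γ.app U) (sheafifyMap_comp e.symm.toHom e.toHom)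
      rw [e.symm_comp_toHom, sheafifyMap_id] at this
      exact this.symm)
    (by
      have := congrArg (fun γ => γ.app U) (sheafifyMap_comp e.toHom e.symm.toHom)
      rw [e.toHom_comp_symm, sheafifyMap_id] at this
      exact this.symm)
  naturality g s := (sheafifyMap e.toHom).naturality g s

end Homs

section Restriction

/-- The inclusion of the category of a smaller sieve, on objects. -/
def incl {K H : Sieve X} (h : K ≤ H) (U : Dom K) : Dom H := ⟨U.obj, h _ U.property⟩

/-- The inclusion of the category of a smaller sieve, on morphisms. -/
def inclMap {K H : Sieve X} (h : K ≤ H) {V U : Dom K} (g : V ⟶ U) : incl h V ⟶ incl h U :=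
  ObjectProperty.homMk g.hom

/-- The restriction of an `H`-presheaf to a smaller sieve `K`. -/
@[reducible]
def restrict (F : ModPresheaf.{u, v} H) (h : K ≤ H) : ModPresheaf.{u, v} K where
  obj U := F.obj (incl h U)
  addCommGroup U := F.addCommGroup (incl h U)
  module U := F.module (incl h U)
  res g := F.res (inclMap h g)
  res_id U s := F.res_id (incl h U) s
  res_comp k g s := F.res_comp (inclMap h k) (inclMap h g) s

/-- Restriction of an isomorphism to a smaller sieve. -/
def Equiv.restrict {F : ModPresheaf.{u, v} H} {G : ModPresheaf.{u, w} H} (e : Equiv F G)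
    (h : K ≤ H) : Equiv (F.restrict h) (G.restrict h) where
  app U := e.app (incl h U)
  naturality g s := e.naturality (inclMap h g) s

/-- An object lying over a `U` in the smaller sieve, as an object of the category of that sieve. -/
def liftDom (K : Sieve X) {V : Dom H} {U : Over X} (hU : K U.hom) (k : V.obj ⟶ U) : Dom K :=
  ⟨V.obj, by rw [← Over.w k]; exact K.downward_closed hU _⟩

lemma mem_restrict_locallyZero (F : ModPresheaf.{u, v} H) (h : K ≤ H) (W : Dom K)
    (s : F.obj (incl h W)) : s ∈ (F.restrict h).locallyZero W ↔ s ∈ F.locallyZero (incl h W) := by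
  constructor
  · rintro ⟨S, hS, hs⟩
    exact ⟨S, hS, fun V g hg => hs (liftDom K W.property g.hom) (ObjectProperty.homMk g.hom) hg⟩
  · rintro ⟨S, hS, hs⟩
    exact ⟨S, hS, fun V g hg => hs (incl h V) (inclMap h g) hg⟩

/-- Restriction of families to a smaller sieve. -/
def famRestrict (F : ModPresheaf.{u, v} H) (h : K ≤ H) (U : Over X) :
    F.Fam U →ₗ[O U] (F.restrict h).Fam U where
  toFun s := fun W k => s (incl h W) k
  map_add' _ _ := rfl
  map_smul' _ _ := rfl

lemma famRestrict_mem_matching (F : ModPresheaf.{u, v} H) (h : K ≤ H) (U : Over X) {s : F.Fam U}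
    (hs : s ∈ F.matching U) : F.famRestrict h U s ∈ (F.restrict h).matching U := by
  obtain ⟨S, hS, hs⟩ := hs
  exact ⟨S, hS, fun V k hk W g => (F.mem_restrict_locallyZero h W _).2
    (hs (incl h V) k hk (incl h W) (inclMap h g))⟩

lemma famRestrict_mem_vanishing (F : ModPresheaf.{u, v} H) (h : K ≤ H) (U : Over X) {s : F.Fam U}
    (hs : s ∈ F.vanishing U) : F.famRestrict h U s ∈ (F.restrict h).vanishing U := by
  obtain ⟨S, hS, hs⟩ := hs
  exact ⟨S, hS, fun V k hk => (F.mem_restrict_locallyZero h V _).2 (hs (incl h V) k hk)⟩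

lemma mem_vanishing_of_famRestrict (F : ModPresheaf.{u, v} H) (h : K ≤ H)
    (hK : K ∈ Scheme.zariskiTopology X) (U : Over X) {s : F.Fam U}
    (hs : F.famRestrict h U s ∈ (F.restrict h).vanishing U) : s ∈ F.vanishing U := by
  obtain ⟨S, hS, hs⟩ := hs
  refine ⟨S ⊓ K.pullback U.hom, Scheme.zariskiTopology.intersection_covering hS
    (Scheme.zariskiTopology.pullback_stable _ hK), fun V k hk => ?_⟩
  have hV : K V.obj.hom := by rw [← Over.w k]; exact hk.2
  exact (F.mem_restrict_locallyZero h ⟨V.obj, hV⟩ _).1 (hs ⟨V.obj, hV⟩ k hk.1)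

open Classical in
lemma exists_famRestrict_eq (F : ModPresheaf.{u, v} H) (h : K ≤ H)
    (hK : K ∈ Scheme.zariskiTopology X) (U : Over X) {t : (F.restrict h).Fam U}
    (ht : t ∈ (F.restrict h).matching U) : ∃ s ∈ F.matching U, F.famRestrict h U s = t := by
  let s : F.Fam U := fun W k =>
    if hW : K W.obj.hom then (t ⟨W.obj, hW⟩ k : F.obj W) else 0
  have hs : F.famRestrict h U s = t := by
    funext W k
    exact dif_pos W.property
  obtain ⟨S, hS, ht⟩ := ht
  refine ⟨s, ⟨S ⊓ K.pullback U.hom, Scheme.zariskiTopology.intersection_covering hS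
    (Scheme.zariskiTopology.pullback_stable _ hK), fun V k hk W g => ?_⟩, hs⟩
  have hV : K V.obj.hom := by rw [← Over.w k]; exact hk.2
  have hW : K W.obj.hom := by rw [← Over.w g.hom]; exact K.downward_closed hV _
  have := (F.mem_restrict_locallyZero h ⟨W.obj, hW⟩ _).1
    (ht ⟨V.obj, hV⟩ k hk.1 ⟨W.obj, hW⟩ (ObjectProperty.homMk g.hom))
  have e1 : s W (g.hom ≫ k) = (t ⟨W.obj, hW⟩ (g.hom ≫ k) : F.obj W) := dif_pos hW
  have e2 : s V k = (t ⟨V.obj, hV⟩ k : F.obj V) := dif_pos hV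
  rw [e1, e2]
  exact this

/-- Restricting families gives the comparison from the sheafification of `F` to that of `F|_K`. -/
def sheafifyRestrictHom (F : ModPresheaf.{u, v} H) (h : K ≤ H) :
    Hom F.sheafify (F.restrict h).sheafify where
  app U := descend (F.famRestrict h U.obj) _ _ _ _ (fun _ => F.famRestrict_mem_matching h U.obj)
    (fun _ => F.famRestrict_mem_vanishing h U.obj)
  naturality g s := by
    obtain ⟨s, rfl⟩ := Submodule.Quotient.mk_surjective _ s
    rfl

/-- For a covering sieve `K ≤ H`, the sheafifications of `F` and of `F|_K` agree. -/
noncomputable def sheafifyRestrict (F : ModPresheaf.{u, v} H) (h : K ≤ H)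
    (hK : K ∈ Scheme.zariskiTopology X) : Equiv F.sheafify (F.restrict h).sheafify :=
  Equiv.ofBijective (F.sheafifyRestrictHom h) (fun U => by
    constructor
    · rw [← LinearMap.ker_eq_bot, LinearMap.ker_eq_bot']
      intro s hs
      obtain ⟨s, hs', rfl⟩ := F.exists_cls U s
      exact (F.cls_eq_zero hs').2 (F.mem_vanishing_of_famRestrict h hK U.obj
        (((F.restrict h).cls_eq_zero (F.famRestrict_mem_matching h U.obj hs')).1 hs))
    · intro t
      obtain ⟨t, ht, rfl⟩ := (F.restrict h).exists_cls U t
      obtain ⟨s, hs, rfl⟩ := F.exists_famRestrict_eq h hK U.obj ht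
      exact ⟨F.cls U s hs, rfl⟩)

end Restriction

section Unit

/-- The `H`-sheaf condition, for covering sieves. -/
def IsSheaf (F : ModPresheaf.{u, v} H) : Prop :=
  ∀ (U : Dom H) (S : Sieve U.obj.left), S ∈ Scheme.zariskiTopology U.obj.left →
    ∀ t : (∀ (V : Dom H) (k : V ⟶ U), S k.hom.left → F.obj V),
      (∀ (V : Dom H) (k : V ⟶ U) (hk : S k.hom.left) (W : Dom H) (g : W ⟶ V),
        t W (g ≫ k) (S.downward_closed hk g.hom.left) = F.res g (t V k hk)) →
      ∃! s : F.obj U, ∀ (V : Dom H) (k : V ⟶ U) (hk : S k.hom.left), F.res k s = t V k hk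

lemma IsSheaf.eq_zero {F : ModPresheaf.{u, v} H} (hF : F.IsSheaf) {U : Dom H} {s : F.obj U}
    (hs : s ∈ F.locallyZero U) : s = 0 := by
  obtain ⟨S, hS, hs⟩ := hs
  exact (hF U S hS (fun _ _ _ => 0) (fun _ _ _ _ _ => (map_zero _).symm)).unique hs
    (fun _ _ _ => map_zero _)

/-- The family of all restrictions of a section. -/
def unitFam (F : ModPresheaf.{u, v} H) (U : Dom H) : F.obj U →ₗ[O U.obj] F.Fam U.obj where
  toFun s := fun V k => F.res (ObjectProperty.homMk k) s
  map_add' s t := by funext V k; exact map_add _ _ _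
  map_smul' r s := by funext V k; exact map_smulₛₗ _ _ _

lemma unitFam_mem_matching (F : ModPresheaf.{u, v} H) (U : Dom H) (s : F.obj U) :
    F.unitFam U s ∈ F.matching U.obj := by
  refine ⟨⊤, Scheme.zariskiTopology.top_mem _, fun V k _ W g => ?_⟩
  have : F.unitFam U s W (g.hom ≫ k) = F.res g (F.unitFam U s V k) :=
    F.res_comp g (ObjectProperty.homMk k) s
  rw [this, sub_self]
  exact zero_mem _

/-- A section of `F` over `U` defines a section of the sheafification over `U`. -/
def unitApp (F : ModPresheaf.{u, v} H) (U : Dom H) : F.obj U →ₗ[O U.obj] F.ShObj U.obj :=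
  (Submodule.mkQ _) ∘ₗ (F.unitFam U).codRestrict (F.matching U.obj) (F.unitFam_mem_matching U)

/-- The unit `F ⟶ (ξ_H F)|_H`. -/
def unit (F : ModPresheaf.{u, v} H) : Hom F (F.sheafify.restrict (le_top : H ≤ ⊤)) where
  app U := F.unitApp U
  naturality {V U} g s := by
    refine congrArg (Submodule.Quotient.mk (p :=
      (F.vanishing V.obj).submoduleOf (F.matching V.obj))) (Subtype.ext ?_)
    funext W k
    exact (F.res_comp (ObjectProperty.homMk k) g s).symm

/-- If `F` is an `H`-sheaf, the unit `F ⟶ (ξ_H F)|_H` is an isomorphism. -/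
noncomputable def unitEquiv (F : ModPresheaf.{u, v} H) (hF : F.IsSheaf) :
    Equiv F (F.sheafify.restrict (le_top : H ≤ ⊤)) :=
  Equiv.ofBijective F.unit (fun U => by
    constructor
    · rw [← LinearMap.ker_eq_bot, LinearMap.ker_eq_bot']
      intro s hs
      obtain ⟨S, hS, h⟩ := (F.cls_eq_zero (U := incl le_top U) (F.unitFam_mem_matching U s)).1 hs
      exact hF.eq_zero ⟨S, hS, fun V g hg => hF.eq_zero (h V g.hom hg)⟩
    · intro t
      obtain ⟨t, ht, rfl⟩ := F.exists_cls (incl le_top U) t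
      obtain ⟨S, hS, h⟩ := id ht
      obtain ⟨s, hs, -⟩ := hF U S hS (fun V k _ => t V k.hom)
        (fun V k hk W g => sub_eq_zero.1 (hF.eq_zero (h V k.hom hk W g)))
      refine ⟨s, (F.cls_eq_cls (U := incl le_top U) (F.unitFam_mem_matching U s) ht).2
        ⟨S, hS, fun V k hk => ?_⟩⟩
      have e : F.unitFam U s V k = t V k := hs V (ObjectProperty.homMk k) hk
      change F.unitFam U s V k - t V k ∈ _
      rw [e, sub_self]
      exact zero_mem _)

end Unit

section Tensor

open TensorProduct

/-- The presheaf tensor product `U ↦ F(U) ⊗ G(U)` over `O U`. -/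
@[reducible]
noncomputable def tensor (F : ModPresheaf.{u, v} H) (G : ModPresheaf.{u, w} H) :
    ModPresheaf.{u, max v w} H where
  obj U := F.obj U ⊗[O U.obj] G.obj U
  res g := TensorProduct.map (F.res g) (G.res g)
  res_id U s := by
    induction s with
    | zero => exact map_zero _
    | add s t hs ht => rw [map_add, hs, ht]
    | tmul a b => rw [TensorProduct.map_tmul, F.res_id, G.res_id]
  res_comp h g s := by
    induction s with
    | zero => simp only [map_zero]
    | add s t hs ht => simp only [map_add, hs, ht]
    | tmul a b => simp only [TensorProduct.map_tmul, F.res_comp, G.res_comp]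

/-- The presheaf tensor product of morphisms. -/
noncomputable def tensorMap {F : ModPresheaf.{u, v} H} {F' : ModPresheaf.{u, v'} H}
    {G : ModPresheaf.{u, w} H} {G' : ModPresheaf.{u, w'} H} (α : Hom F F') (β : Hom G G') :
    Hom (F.tensor G) (F'.tensor G') where
  app U := TensorProduct.map (α.app U) (β.app U)
  naturality g s := by
    induction s using TensorProduct.induction_on with
    | zero => simp only [map_zero]
    | add s t hs ht => simp only [map_add, hs, ht]
    | tmul a b => simp only [tensor, TensorProduct.map_tmul, α.naturality, β.naturality]

lemma tensorMap_id (F : ModPresheaf.{u, v} H) (G : ModPresheaf.{u, w} H) :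
    tensorMap (Hom.id F) (Hom.id G) = Hom.id (F.tensor G) := by
  refine Hom.ext (funext fun U => LinearMap.ext fun s => ?_)
  exact LinearMap.congr_fun (TensorProduct.map_id (R := O U.obj) (M := F.obj U) (N := G.obj U)) s

lemma tensorMap_comp {F F' F'' : ModPresheaf.{u, v} H} {G G' G'' : ModPresheaf.{u, w} H}
    (α : Hom F F') (α' : Hom F' F'') (β : Hom G G') (β' : Hom G' G'') :
    tensorMap (α.comp α') (β.comp β') = (tensorMap α β).comp (tensorMap α' β') := by
  refine Hom.ext (funext fun U => LinearMap.ext fun s => ?_)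
  exact LinearMap.congr_fun
    (TensorProduct.map_comp (α'.app U) (β'.app U) (α.app U) (β.app U)) s

/-- The presheaf tensor product of isomorphisms. -/
noncomputable def tensorEquiv {F : ModPresheaf.{u, v} H} {F' : ModPresheaf.{u, v'} H}
    {G : ModPresheaf.{u, w} H} {G' : ModPresheaf.{u, w'} H} (α : Equiv F F') (β : Equiv G G') :
    Equiv (F.tensor G) (F'.tensor G') where
  app U := TensorProduct.congr (α.app U) (β.app U)
  naturality g s := (tensorMap α.toHom β.toHom).naturality g s

end Tensor

section Basis

variable {F : ModPresheaf.{u, v} H}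

/-- A finite family `b` of sections of `F` over `U` defines a map from the free presheaf of rank `n` on
the big Zariski site of `U` to the pullback of `F` to `U`. This is its component over `g : V ⟶ U`:
`(a_1, …, a_n) ↦ ∑ a_i b_i|_V`. -/
noncomputable def frame (F : ModPresheaf.{u, v} H) {U : Dom H} {n : ℕ} (b : Fin n → F.obj U)
    {V : Dom H} (g : V ⟶ U) : (Fin n → O V.obj) →ₗ[O V.obj] F.obj V :=
  Fintype.linearCombination (O V.obj) (fun i => F.res g (b i))

/-- The map from the free presheaf on the big Zariski site of `U` defined by `b` is an isomorphism. -/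
def IsLocalBasis (F : ModPresheaf.{u, v} H) {U : Dom H} {n : ℕ} (b : Fin n → F.obj U) : Prop :=
  ∀ (V : Dom H) (g : V ⟶ U), Function.Bijective (F.frame b g)

lemma frame_res {U : Dom H} {n : ℕ} (b : Fin n → F.obj U) {W V : Dom H} (h : W ⟶ V) (g : V ⟶ U)
    (a : Fin n → O V.obj) : F.res h (F.frame b g a) = F.frame b (h ≫ g) (fun i => resO h.hom (a i)) := by
  simp only [frame, Fintype.linearCombination_apply, map_sum, map_smulₛₗ, F.res_comp]

lemma exists_glue {U : Scheme.{u}} {S : Sieve U} (hS : S ∈ Scheme.zariskiTopology U)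
    (t : ∀ (V : Scheme.{u}) (k : V ⟶ U), S k → Γ(V, ⊤))
    (ht : ∀ (V : Scheme.{u}) (k : V ⟶ U) (hk : S k) (W : Scheme.{u}) (g : W ⟶ V),
      t W (g ≫ k) (S.downward_closed hk g) = g.appTop.hom (t V k hk)) :
    ∃! r : Γ(U, ⊤), ∀ (V : Scheme.{u}) (k : V ⟶ U) (hk : S k), k.appTop.hom r = t V k hk := by
  let e (V : Scheme.{u}) := AffineSpace.toSpecMvPolyIntEquiv (PUnit.{u+1}) (X := V)
  have hsh := GrothendieckTopology.Subcanonical.isSheaf_of_isRepresentable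
    (J := Scheme.zariskiTopology.{u}) (yoneda.obj (Spec (.of (MvPolynomial (PUnit.{u+1}) (ULift.{u} ℤ))))) S hS
  let x : Presieve.FamilyOfElements (yoneda.obj (Spec (.of (MvPolynomial (PUnit.{u+1}) (ULift.{u} ℤ))))) S.arrows :=
    fun V k hk => (e V).symm (fun _ => t V k hk)
  have he : ∀ (V W : Scheme.{u}) (g : W ⟶ V) (r : Γ(V, ⊤)),
      g ≫ (e V).symm (fun _ => r) = (e W).symm (fun _ => g.appTop.hom r) := by
    intro V W g r
    rw [Equiv.eq_symm_apply]
    funext i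
    rw [AffineSpace.toSpecMvPolyIntEquiv_comp, Equiv.apply_symm_apply]
  have hx : x.Compatible := by
    rw [Presieve.compatible_iff_sieveCompatible]
    intro V W k g hk
    change (e W).symm _ = g ≫ (e V).symm _
    rw [he]
    congr 1
    funext _
    exact ht V k hk W g
  obtain ⟨y, hy, hy'⟩ := hsh x hx
  refine ⟨e U y ⟨⟩, fun V k hk => ?_, fun r hr => ?_⟩
  · have := hy k hk
    change k ≫ y = (e V).symm _ at this
    rw [Equiv.eq_symm_apply] at this
    rw [← congrFun this ⟨⟩]
    exact AffineSpace.toSpecMvPolyIntEquiv_comp _ _ _ _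
  · have := hy' ((e U).symm (fun _ => r)) (fun V k hk => by
      change k ≫ (e U).symm _ = (e V).symm _
      rw [he, hr V k hk])
    rw [← this, Equiv.apply_symm_apply]

lemma isSheaf_of_isLocalBasis (hF : ∀ U : Dom H, ∃ (n : ℕ) (b : Fin n → F.obj U), F.IsLocalBasis b) :
    F.IsSheaf := by
  intro U S hS t ht
  obtain ⟨n, b, hb⟩ := hF U
  -- the coefficients of the family with respect to the local basis
  choose c hc using fun (V : Dom H) (k : V ⟶ U) (hk : S k.hom.left) => (hb V k).2 (t V k hk)
  have hcc : ∀ (V : Dom H) (k : V ⟶ U) (hk : S k.hom.left) (W : Dom H) (g : W ⟶ V) (i : Fin n),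
      c W (g ≫ k) (S.downward_closed hk g.hom.left) i = resO g.hom (c V k hk i) := by
    intro V k hk W g
    refine congrFun ((hb W (g ≫ k)).1 ?_)
    rw [hc, ht V k hk, ← hc V k hk, frame_res]
  let D (V : Scheme.{u}) (k : V ⟶ U.obj.left) : Dom H :=
    ⟨Over.mk (k ≫ U.obj.hom), H.downward_closed U.property k⟩
  let d (V : Scheme.{u}) (k : V ⟶ U.obj.left) : D V k ⟶ U := ObjectProperty.homMk (Over.homMk k)
  have hgl := fun i => exists_glue hS (fun V k hk => c (D V k) (d V k) hk i) (fun V k hk W g => by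
    let g' : D W (g ≫ k) ⟶ D V k := ObjectProperty.homMk (Over.homMk g (by simp [D]))
    exact hcc (D V k) (d V k) hk _ g' i)
  have key : ∀ (a : Fin n → O U.obj), (∀ (V : Dom H) (k : V ⟶ U) (hk : S k.hom.left),
      F.res k (F.frame b (𝟙 U) a) = t V k hk) ↔
      ∀ i (V : Scheme.{u}) (k : V ⟶ U.obj.left) (hk : S k), k.appTop.hom (a i) = c (D V k) (d V k) hk i := by
    intro a
    have h1 : ∀ (V : Dom H) (k : V ⟶ U) (hk : S k.hom.left),
      F.res k (F.frame b (𝟙 U) a) = t V k hk ↔ ∀ i, resO k.hom (a i) = c V k hk i := by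
      intro V k hk
      rw [frame_res, Category.comp_id, ← hc V k hk, (hb V k).1.eq_iff, funext_iff]
    constructor
    · intro h i V k hk
      exact (h1 (D V k) (d V k) hk).1 (h _ _ hk) i
    · intro h V k hk
      refine (h1 V k hk).2 fun i => ?_
      let g : V ⟶ D V.obj.left k.hom.left :=
        ObjectProperty.homMk (Over.homMk (𝟙 _) (by simp [D]))
      have hg : k = g ≫ d V.obj.left k.hom.left := by
        ext; simp [g, d]
      have h2 := hcc _ (d V.obj.left k.hom.left) hk V g i
      have h3 : resO k.hom (a i) = c _ (d V.obj.left k.hom.left) hk i := h i V.obj.left k.hom.left hk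
      have h4 : ∀ (k' : V ⟶ U) (e : k = k') (hk' : S k'.hom.left), c V k hk i = c V k' hk' i := by
        rintro _ rfl _; rfl
      rw [h4 _ hg (S.downward_closed hk g.hom.left), h2, h3]
      exact (resO_id _ _).symm
  choose a ha ha' using hgl
  refine ⟨F.frame b (𝟙 U) a, (key a).2 ha, fun s hs => ?_⟩
  obtain ⟨a', rfl⟩ := (hb U (𝟙 U)).2 s
  rw [funext (fun i => ha' i (a' i) ((key a').1 hs i))]

end Basis

end ModPresheaf

section Standard

open TensorProduct

variable {H K : Sieve X}

/-- An `H`-presheaf of modules whose value at every object `U` of the category of `H` is a standard free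
module `O(U)^n`, where `n` depends on `U`. As a standard free module consists of `n`-tuples, the number
`n` belongs to the data. -/
structure StdPresheaf (H : Sieve X) where
  rank : Dom H → ℕ
  res : ∀ {V U : Dom H} (g : V ⟶ U),
    (Fin (rank U) → O U.obj) →ₛₗ[resO g.hom] (Fin (rank V) → O V.obj)
  res_id : ∀ (U : Dom H) (s : Fin (rank U) → O U.obj), res (𝟙 U) s = s
  res_comp : ∀ {W V U : Dom H} (h : W ⟶ V) (g : V ⟶ U) (s : Fin (rank U) → O U.obj),
    res (h ≫ g) s = res h (res g s)

namespace StdPresheaf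

/-- The underlying `H`-presheaf of modules. -/
@[reducible]
def toMod (E : StdPresheaf H) : ModPresheaf.{u, u} H where
  obj U := Fin (E.rank U) → O U.obj
  res := E.res
  res_id := E.res_id
  res_comp := E.res_comp

/-- The condition on a standard vector bundle: at each object `U`, the map from the free presheaf on the
big Zariski site of `U` induced by the standard basis of `E(U) = O(U)^n` is an isomorphism. -/
def IsStandard (E : StdPresheaf H) : Prop :=
  ∀ U : Dom H, E.toMod.IsLocalBasis (U := U) (fun i : Fin (E.rank U) => Pi.single i 1)

lemma IsStandard.isSheaf {E : StdPresheaf H} (hE : E.IsStandard) : E.toMod.IsSheaf :=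
  ModPresheaf.isSheaf_of_isLocalBasis fun U => ⟨_, _, hE U⟩

/-- Standardization of a presheaf `F` by isomorphisms `φ U : O(U)^n ≃ F(U)`: the presheaf with values
`O(U)^n` and restriction maps `φ_V⁻¹ ∘ F(g) ∘ φ_U`. -/
def standardize (F : ModPresheaf.{u, v} H) (n : Dom H → ℕ)
    (φ : ∀ U : Dom H, (Fin (n U) → O U.obj) ≃ₗ[O U.obj] F.obj U) : StdPresheaf H where
  rank := n
  res {V U} g := ((φ V).symm.toLinearMap.comp (F.res g)).comp (φ U).toLinearMap
  res_id U s := by simp [F.res_id]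
  res_comp h g s := by simp [F.res_comp]

/-- The isomorphism from the standardization to `F` given by `φ`. -/
def standardizeEquiv (F : ModPresheaf.{u, v} H) (n : Dom H → ℕ)
    (φ : ∀ U : Dom H, (Fin (n U) → O U.obj) ≃ₗ[O U.obj] F.obj U) :
    ModPresheaf.Equiv (standardize F n φ).toMod F where
  app := φ
  naturality {V _} _ _ := (φ V).apply_symm_apply _

lemma isStandard_standardize (F : ModPresheaf.{u, v} H) (n : Dom H → ℕ)
    (φ : ∀ U : Dom H, (Fin (n U) → O U.obj) ≃ₗ[O U.obj] F.obj U)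
    (hφ : ∀ U : Dom H, F.IsLocalBasis (fun i => φ U (Pi.single i 1))) :
    (standardize F n φ).IsStandard := by
  intro U V g
  have : ⇑((standardize F n φ).toMod.frame (U := U) (fun i => Pi.single i 1) g) =
      (φ V).symm ∘ F.frame (fun i => φ U (Pi.single i 1)) g := by
    funext a
    change ∑ i, a i • (φ V).symm (F.res g (φ U (Pi.single i 1))) =
      (φ V).symm (∑ i, a i • F.res g (φ U (Pi.single i 1)))
    simp only [map_sum, map_smul]
  rw [this]
  exact (φ V).symm.bijective.comp (hφ U V g)

end StdPresheaf

/-- The isomorphism `A^r ⊗ A^s ≃ A^(rs)`,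
`(a_1, …, a_r) ⊗ (b_1, …, b_s) ↦ (a_1 b_1, …, a_1 b_s, …, a_r b_1, …, a_r b_s)`, see `kron_tmul`;
`finProdFinEquiv` is the lexicographic numbering of pairs. -/
noncomputable def kron (A : Type u) [CommRing A] (r s : ℕ) :
    (Fin r → A) ⊗[A] (Fin s → A) ≃ₗ[A] (Fin (r * s) → A) :=
  (((Pi.basisFun A (Fin r)).tensorProduct (Pi.basisFun A (Fin s))).reindex
    finProdFinEquiv).equivFun

lemma kron_tmul (A : Type u) [CommRing A] (r s : ℕ) (a : Fin r → A) (b : Fin s → A)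
    (i : Fin r) (j : Fin s) : kron A r s (a ⊗ₜ b) (finProdFinEquiv (i, j)) = a i * b j := by
  simp [kron, mul_comm]

lemma kron_symm_single (A : Type u) [CommRing A] (r s : ℕ) (i : Fin r) (j : Fin s) :
    (kron A r s).symm (Pi.single (finProdFinEquiv (i, j)) 1) = Pi.single i 1 ⊗ₜ Pi.single j 1 := by
  rw [LinearEquiv.symm_apply_eq]
  funext m
  obtain ⟨⟨k, l⟩, rfl⟩ := finProdFinEquiv.surjective m
  rw [kron_tmul]
  simp only [Pi.single_apply, finProdFinEquiv.injective.eq_iff, Prod.mk.injEq]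
  split_ifs <;> simp_all

lemma isLocalBasis_tensor {F : ModPresheaf.{u, v} H} {G : ModPresheaf.{u, w} H} {U : Dom H}
    {m n : ℕ} {b : Fin m → F.obj U} {c : Fin n → G.obj U} (hb : F.IsLocalBasis b)
    (hc : G.IsLocalBasis c) {d : Fin (m * n) → (F.tensor G).obj U}
    (hd : ∀ i j, d (finProdFinEquiv (i, j)) = b i ⊗ₜ c j) : (F.tensor G).IsLocalBasis d := by
  intro V g
  have : (F.tensor G).frame d g = ((kron (O V.obj) m n).symm.trans (TensorProduct.congr
      (LinearEquiv.ofBijective _ (hb V g)) (LinearEquiv.ofBijective _ (hc V g)))).toLinearMap := by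
    refine (Pi.basisFun (O V.obj) (Fin (m * n))).ext fun k => ?_
    obtain ⟨⟨i, j⟩, rfl⟩ := finProdFinEquiv.surjective k
    rw [Pi.basisFun_apply, LinearEquiv.coe_coe, LinearEquiv.trans_apply, kron_symm_single]
    rw [TensorProduct.congr_tmul, ModPresheaf.frame, Fintype.linearCombination_apply_single,
      one_smul, hd]
    simp only [LinearEquiv.ofBijective_apply, ModPresheaf.frame,
      Fintype.linearCombination_apply_single, one_smul]
    exact TensorProduct.map_tmul _ _ _ _
  rw [this]
  exact LinearEquiv.bijective _

lemma isLocalBasis_restrict {F : ModPresheaf.{u, v} H} (h : K ≤ H) {U : Dom K} {n : ℕ}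
    {b : Fin n → F.obj (ModPresheaf.incl h U)} (hb : F.IsLocalBasis b) :
    (F.restrict h).IsLocalBasis (U := U) b :=
  fun V g => hb (ModPresheaf.incl h V) (ModPresheaf.inclMap h g)

end Standard

section Bundles

open TensorProduct ModPresheaf

/-- A standard vector bundle on `X`: a sieve `H` on `X` that contains a Zariski covering of `X`, and an
`H`-presheaf with values in standard free modules that satisfies `IsStandard`. -/
structure StdVB (X : Scheme.{u}) where
  sieve : Sieve X
  covering : sieve ∈ Scheme.zariskiTopology X
  presheaf : StdPresheaf sieve
  standard : presheaf.IsStandard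

namespace StdVB

/-- The presheaf of modules on the associated sieve. -/
abbrev mod (E : StdVB X) : ModPresheaf.{u, u} E.sieve := E.presheaf.toMod

/-- The associated sheaf on the big Zariski site. -/
noncomputable abbrev sheaf (E : StdVB X) : ModPresheaf.{u, u + 1} (⊤ : Sieve X) := E.mod.sheafify

/-- The category of standard vector bundles: morphisms are the morphisms of the associated sheaves. -/
noncomputable instance : Category (StdVB X) where
  Hom E F := ModPresheaf.Hom E.sheaf F.sheaf
  id E := ModPresheaf.Hom.id E.sheaf
  comp α β := ModPresheaf.Hom.comp α β

/-- The presheaf tensor product of the bundles, on the intersection of the two sieves. -/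
noncomputable def tensorMod (E F : StdVB X) : ModPresheaf.{u, u} (E.sieve ⊓ F.sieve) :=
  (E.mod.restrict inf_le_left).tensor (F.mod.restrict inf_le_right)

/-- The tensor product of standard vector bundles: standardize the presheaf tensor product by means of
the isomorphisms `kron`. -/
noncomputable def tensorObj (E F : StdVB X) : StdVB X where
  sieve := E.sieve ⊓ F.sieve
  covering := Scheme.zariskiTopology.intersection_covering E.covering F.covering
  presheaf := StdPresheaf.standardize (E.tensorMod F)
    (fun U => E.presheaf.rank (incl inf_le_left U) * F.presheaf.rank (incl inf_le_right U))
    (fun U => (kron (O U.obj) _ _).symm)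
  standard := by
    refine StdPresheaf.isStandard_standardize _ _ _ fun U => ?_
    refine isLocalBasis_tensor
      (isLocalBasis_restrict inf_le_left (E.standard (incl inf_le_left U)))
      (isLocalBasis_restrict inf_le_right (F.standard (incl inf_le_right U))) fun i j => ?_
    exact kron_symm_single _ _ _ i j

/-- The isomorphism
`ζ : ξ(E ⊗ F) ≅ ξ(E ⊗ᵖ F) ≅ ξ((ξE ⊗ᵖ ξF)|_(H ⊓ K)) ≅ ξ(ξE ⊗ᵖ ξF)`, where `⊗ᵖ` is the presheaf tensor
product. -/
noncomputable def zeta (E F : StdVB X) :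
    Equiv (E.tensorObj F).sheaf (E.sheaf.tensor F.sheaf).sheafify :=
  let e₁ : Equiv (E.tensorObj F).mod (E.tensorMod F) := StdPresheaf.standardizeEquiv _ _ _
  let e₂ : Equiv (E.tensorMod F) ((E.sheaf.tensor F.sheaf).restrict le_top) :=
    tensorEquiv ((E.mod.unitEquiv E.standard.isSheaf).restrict inf_le_left)
      ((F.mod.unitEquiv F.standard.isSheaf).restrict inf_le_right)
  ((sheafifyEquiv e₁).trans (sheafifyEquiv e₂)).trans
    ((E.sheaf.tensor F.sheaf).sheafifyRestrict le_top (E.tensorObj F).covering).symm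

/-- The tensor product of morphisms: `ζ⁻¹ ∘ ξ(γ ⊗ᵖ δ) ∘ ζ`. -/
noncomputable def tensorHom {E E' F F' : StdVB X} (γ : E ⟶ E') (δ : F ⟶ F') :
    E.tensorObj F ⟶ E'.tensorObj F' :=
  ((E.zeta F).toHom.comp (sheafifyMap (tensorMap γ δ))).comp (E'.zeta F').symm.toHom

lemma tensorHom_id (E F : StdVB X) : tensorHom (𝟙 E) (𝟙 F) = 𝟙 (E.tensorObj F) := by
  have : tensorMap (𝟙 E : E ⟶ E) (𝟙 F : F ⟶ F) = ModPresheaf.Hom.id (E.sheaf.tensor F.sheaf) :=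
    tensorMap_id E.sheaf F.sheaf
  rw [tensorHom, this, ModPresheaf.sheafifyMap_id]
  exact (E.zeta F).toHom_comp_symm

lemma tensorHom_comp {E E' E'' F F' F'' : StdVB X} (γ : E ⟶ E') (γ' : E' ⟶ E'') (δ : F ⟶ F')
    (δ' : F' ⟶ F'') : tensorHom (γ ≫ γ') (δ ≫ δ') = tensorHom γ δ ≫ tensorHom γ' δ' := by
  have : tensorMap (γ ≫ γ') (δ ≫ δ') = (tensorMap γ δ).comp (tensorMap γ' δ') :=
    tensorMap_comp γ γ' δ δ'
  rw [tensorHom, this, ModPresheaf.sheafifyMap_comp]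
  refine ModPresheaf.Hom.ext (funext fun U => LinearMap.ext fun s => ?_)
  exact congrArg (fun t => ((E''.zeta F'').app U).symm
    ((ModPresheaf.sheafifyMap (tensorMap γ' δ')).app U t))
    (((E'.zeta F').app U).apply_symm_apply _).symm

/-- The tensor product bifunctor. -/
noncomputable def tensor (X : Scheme.{u}) : StdVB X × StdVB X ⥤ StdVB X where
  obj p := p.1.tensorObj p.2
  map f := tensorHom f.1 f.2
  map_id p := tensorHom_id p.1 p.2
  map_comp f g := tensorHom_comp f.1 g.1 f.2 g.2

/-- Componentwise restriction of tuples of functions. -/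
def freeRes (n : ℕ) {V U : Over X} (g : V ⟶ U) : (Fin n → O U) →ₛₗ[resO g] (Fin n → O V) where
  toFun s i := resO g (s i)
  map_add' s t := funext fun i => (resO g).map_add (s i) (t i)
  map_smul' r s := funext fun i => (resO g).map_mul r (s i)

/-- The free presheaf `U ↦ O(U)^n` on the big Zariski site. -/
def freePresheaf (X : Scheme.{u}) (n : ℕ) : StdPresheaf (⊤ : Sieve X) where
  rank _ := n
  res g := freeRes n g.hom
  res_id U s := funext fun i => resO_id U.obj (s i)
  res_comp h g s := funext fun i => resO_comp h.hom g.hom (s i)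

lemma freePresheaf_isStandard (X : Scheme.{u}) (n : ℕ) : (freePresheaf X n).IsStandard := by
  intro U V g
  have : ⇑((freePresheaf X n).toMod.frame (U := U) (fun i => Pi.single i 1) g) = _root_.id := by
    refine funext fun (a : Fin n → O V.obj) => ?_
    change (∑ j : Fin n, a j • (freeRes n g.hom (Pi.single j 1))) = a
    have h : ∀ j : Fin n, freeRes n g.hom (Pi.single j 1) = (Pi.single j 1 : Fin n → O V.obj) := by
      intro j
      funext i
      change resO g.hom ((Pi.single j 1 : Fin n → O U.obj) i) = _
      by_cases hij : i = j
      · subst hij; simp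
      · simp [hij]
    simp only [h]
    funext i
    simp [Finset.sum_apply, Pi.single_apply]
  rw [this]
  exact Function.bijective_id

/-- The trivial standard vector bundle of rank `n`; for `n = 1` it is the trivial standard line bundle. -/
noncomputable def trivial (X : Scheme.{u}) (n : ℕ) : StdVB X where
  sieve := ⊤
  covering := Scheme.zariskiTopology.top_mem X
  presheaf := freePresheaf X n
  standard := freePresheaf_isStandard X n

/-- Standard line bundles: the rank is 1 at all objects. -/
def IsLine : ObjectProperty (StdVB X) := fun E => ∀ U, E.presheaf.rank U = 1

/-- The category of standard line bundles, a full subcategory. -/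
abbrev LineBundle (X : Scheme.{u}) := (IsLine (X := X)).FullSubcategory

end StdVB

end Bundles

end Presheaves

section Pullback

open ModPresheaf

variable {X Y : Scheme.{u}} (f : Y ⟶ X)

/-- Composition with `f : Y ⟶ X`, from the category of `f^*H` (or of a smaller sieve) to that of `H`,
on objects. The underlying scheme does not change. -/
def push {H : Sieve X} {K : Sieve Y} (h : K ≤ H.pullback f) (U : Dom K) : Dom H :=
  ⟨(Over.map f).obj U.obj, h _ U.property⟩

/-- Composition with `f`, on morphisms. -/
def pushMap {H : Sieve X} {K : Sieve Y} (h : K ≤ H.pullback f) {V U : Dom K} (g : V ⟶ U) :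
    push f h V ⟶ push f h U :=
  ObjectProperty.homMk ((Over.map f).map g.hom)

lemma pushMap_id {H : Sieve X} {K : Sieve Y} (h : K ≤ H.pullback f) (U : Dom K) :
    pushMap f h (𝟙 U) = 𝟙 (push f h U) := by
  ext; simp [pushMap, push]

lemma pushMap_comp {H : Sieve X} {K : Sieve Y} (h : K ≤ H.pullback f) {W V U : Dom K}
    (k : W ⟶ V) (g : V ⟶ U) : pushMap f h (k ≫ g) = pushMap f h k ≫ pushMap f h g := by
  ext; simp [pushMap, push]

namespace ModPresheaf

variable {H : Sieve X} {K : Sieve Y}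

/-- The pullback `f^*F` of an `H`-presheaf, on `f^*H` or a smaller sieve: its value at `U ⟶ Y` is
the value of `F` at `U ⟶ Y ⟶ X`. -/
@[reducible]
def pullback (F : ModPresheaf.{u, v} H) (h : K ≤ H.pullback f) : ModPresheaf.{u, v} K where
  obj U := F.obj (push f h U)
  addCommGroup U := F.addCommGroup (push f h U)
  module U := F.module (push f h U)
  res g := F.res (pushMap f h g)
  res_id U s := (F.res_congr (pushMap_id f h U) s).trans (F.res_id _ s)
  res_comp k g s := (F.res_congr (pushMap_comp f h k g) s).trans (F.res_comp _ _ s)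

/-- The pullback of a morphism of presheaves. -/
def Hom.pullback {F : ModPresheaf.{u, v} H} {G : ModPresheaf.{u, w} H} (α : Hom F G)
    (h : K ≤ H.pullback f) : Hom (F.pullback f h) (G.pullback f h) where
  app U := α.app (push f h U)
  naturality g s := α.naturality (pushMap f h g) s

lemma res_mem_locallyZero (F : ModPresheaf.{u, v} H) {V U : Dom H} (g : V ⟶ U) {s : F.obj U}
    (hs : s ∈ F.locallyZero U) : F.res g s ∈ F.locallyZero V := by
  obtain ⟨S, hS, hs⟩ := hs
  exact ⟨S.pullback g.hom.left, Scheme.zariskiTopology.pullback_stable _ hS,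
    fun W k hk => by rw [← F.res_comp]; exact hs W (k ≫ g) hk⟩

section Comparison

/-- A scheme over `X` in the category of `H` with a map to `U`, where `U` is a scheme over `Y`, is a scheme
over `Y`. -/
def pulled {W : Dom H} {U : Over Y} (k : W.obj ⟶ (Over.map f).obj U) : Dom (H.pullback f) :=
  ⟨Over.mk (k.left ≫ U.hom), by
    have : (k.left ≫ U.hom) ≫ f = W.obj.hom := by
      rw [Category.assoc]; exact Over.w k
    change H ((k.left ≫ U.hom) ≫ f)
    rw [this]
    exact W.property⟩

/-- The morphism to `U`, over `Y`. -/
def pulledHom {W : Dom H} {U : Over Y} (k : W.obj ⟶ (Over.map f).obj U) :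
    (pulled f k).obj ⟶ U := Over.homMk k.left

/-- The canonical isomorphism over `X`, given by the identity. -/
def pulledUnit {W : Dom H} {U : Over Y} (k : W.obj ⟶ (Over.map f).obj U) :
    W ⟶ push f le_rfl (pulled f k) :=
  ObjectProperty.homMk (Over.homMk (𝟙 W.obj.left) (by
    refine (Category.id_comp ((k.left ≫ U.hom) ≫ f)).trans ?_
    rw [Category.assoc]; exact Over.w k))

lemma pulledUnit_comp {W : Dom H} {U : Over Y} (k : W.obj ⟶ (Over.map f).obj U) :
    (pulledUnit f k).hom ≫ (Over.map f).map (pulledHom f k) = k := by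
  ext
  exact Category.id_comp _

lemma mem_pullback_locallyZero (F : ModPresheaf.{u, v} H) (W : Dom (H.pullback f))
    (s : F.obj (push f le_rfl W)) :
    s ∈ (F.pullback f le_rfl).locallyZero W ↔ s ∈ F.locallyZero (push f le_rfl W) := by
  constructor
  · rintro ⟨S, hS, hs⟩
    refine ⟨S, hS, fun V g hg => ?_⟩
    have e : g = pulledUnit f g.hom ≫ pushMap f le_rfl
        (ObjectProperty.homMk (pulledHom f g.hom) : pulled f g.hom ⟶ W) := by
      ext : 1
      exact (pulledUnit_comp f g.hom).symm
    have h0 := hs (pulled f g.hom) (ObjectProperty.homMk (pulledHom f g.hom)) hg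
    rw [e, F.res_comp]
    exact (congrArg _ h0).trans (map_zero _)
  · rintro ⟨S, hS, hs⟩
    exact ⟨S, hS, fun V g hg => hs (push f le_rfl V) (pushMap f le_rfl g) hg⟩

/-- The families over `U`, seen as a scheme over `X`, form a module over the same ring. -/
instance famPushModule (F : ModPresheaf.{u, v} H) (U : Over Y) :
    Module (O U) (F.Fam ((Over.map f).obj U)) :=
  inferInstanceAs (Module (O ((Over.map f).obj U)) (F.Fam ((Over.map f).obj U)))

/-- Families over `U` seen as a scheme over `X` give families over `U` as a scheme over `Y`. -/
def famPullback (F : ModPresheaf.{u, v} H) (U : Over Y) :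
    F.Fam ((Over.map f).obj U) →ₗ[O U] (F.pullback f le_rfl).Fam U where
  toFun s := fun W k => s (push f le_rfl W) ((Over.map f).map k)
  map_add' _ _ := rfl
  map_smul' _ _ := rfl

lemma famPullback_mem_matching (F : ModPresheaf.{u, v} H) (U : Over Y)
    {s : F.Fam ((Over.map f).obj U)} (hs : s ∈ F.matching ((Over.map f).obj U)) :
    famPullback f F U s ∈ (F.pullback f le_rfl).matching U := by
  obtain ⟨S, hS, hs⟩ := hs
  refine ⟨S, hS, fun V k hk W g => (mem_pullback_locallyZero f F W _).2 ?_⟩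
  have := hs (push f le_rfl V) ((Over.map f).map k) hk (push f le_rfl W) (pushMap f le_rfl g)
  change s (push f le_rfl W) ((Over.map f).map (g.hom ≫ k)) - _ ∈ _
  rw [Functor.map_comp]
  exact this

lemma famPullback_mem_vanishing (F : ModPresheaf.{u, v} H) (U : Over Y)
    {s : F.Fam ((Over.map f).obj U)} (hs : s ∈ F.vanishing ((Over.map f).obj U)) :
    famPullback f F U s ∈ (F.pullback f le_rfl).vanishing U := by
  obtain ⟨S, hS, hs⟩ := hs
  exact ⟨S, hS, fun V k hk => (mem_pullback_locallyZero f F V _).2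
    (hs (push f le_rfl V) ((Over.map f).map k) hk)⟩

lemma mem_vanishing_of_famPullback (F : ModPresheaf.{u, v} H) (U : Over Y)
    {s : F.Fam ((Over.map f).obj U)} (hs : s ∈ F.matching ((Over.map f).obj U))
    (h : famPullback f F U s ∈ (F.pullback f le_rfl).vanishing U) :
    s ∈ F.vanishing ((Over.map f).obj U) := by
  obtain ⟨S, hS, hs⟩ := hs
  obtain ⟨T, hT, ht⟩ := h
  refine ⟨S ⊓ T, Scheme.zariskiTopology.intersection_covering hS hT, fun V k hk => ?_⟩
  have h1 := (mem_pullback_locallyZero f F _ _).1 (ht (pulled f k) (pulledHom f k) hk.2)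
  have h2 := hs (push f le_rfl (pulled f k)) ((Over.map f).map (pulledHom f k)) hk.1 V
    (pulledUnit f k)
  rw [pulledUnit_comp] at h2
  have h3 := add_mem h2 (F.res_mem_locallyZero (pulledUnit f k) h1)
  rwa [show famPullback f F U s (pulled f k) (pulledHom f k) =
    s (push f le_rfl (pulled f k)) ((Over.map f).map (pulledHom f k)) from rfl,
    sub_add_cancel] at h3

lemma exists_famPullback (F : ModPresheaf.{u, v} H) (U : Over Y)
    {t : (F.pullback f le_rfl).Fam U} (ht : t ∈ (F.pullback f le_rfl).matching U) :
    ∃ s ∈ F.matching ((Over.map f).obj U),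
      famPullback f F U s - t ∈ (F.pullback f le_rfl).vanishing U := by
  obtain ⟨S, hS, ht⟩ := ht
  let s : F.Fam ((Over.map f).obj U) := fun W k =>
    F.res (pulledUnit f k) (t (pulled f k) (pulledHom f k))
  refine ⟨s, ⟨S, hS, fun V k hk W g => ?_⟩, ⟨S, hS, fun W k hk => ?_⟩⟩
  · let g' : pulled f (g.hom ≫ k) ⟶ pulled f k :=
      ObjectProperty.homMk (Over.homMk g.hom.left (by simp [pulled]))
    have e1 : g'.hom ≫ pulledHom f k = pulledHom f (g.hom ≫ k) := by
      ext; rfl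
    have e2 : pulledUnit f (g.hom ≫ k) ≫ pushMap f le_rfl g' = g ≫ pulledUnit f k := by
      ext
      change 𝟙 _ ≫ g.hom.left = g.hom.left ≫ 𝟙 _
      rw [Category.id_comp, Category.comp_id]
    have h1 := ht (pulled f k) (pulledHom f k) hk _ g'
    rw [e1] at h1
    have h2 := F.res_mem_locallyZero (pulledUnit f (g.hom ≫ k))
      ((mem_pullback_locallyZero f F _ _).1 h1)
    rw [map_sub] at h2
    have h3 : F.res (pulledUnit f (g.hom ≫ k)) ((F.pullback f le_rfl).res g'
        (t (pulled f k) (pulledHom f k))) = F.res g (s V k) := by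
      refine (F.res_comp _ _ _).symm.trans ?_
      rw [e2]
      exact F.res_comp _ _ _
    rw [h3] at h2
    exact h2
  · let k₀ : (push f le_rfl W).obj ⟶ (Over.map f).obj U := (Over.map f).map k
    let e' : W ⟶ pulled f k₀ :=
      ObjectProperty.homMk (Over.homMk (𝟙 W.obj.left)
        ((Category.id_comp _).trans (Over.w k)))
    have e1 : e'.hom ≫ pulledHom f k₀ = k := by
      ext; exact Category.id_comp _
    have h1 := ht _ (pulledHom f k₀) hk W e'
    rw [e1] at h1
    have h2 := neg_mem h1
    rw [neg_sub] at h2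
    exact h2

/-- The comparison map of the next definition. -/
def sheafifyPullbackHom (F : ModPresheaf.{u, v} H) :
    Hom (F.sheafify.pullback f (K := ⊤) (by rw [Sieve.pullback_top]))
      (F.pullback f le_rfl).sheafify where
  app U := descend (famPullback f F U.obj) _ _ _ _ (fun _ => famPullback_mem_matching f F U.obj)
    (fun _ => famPullback_mem_vanishing f F U.obj)
  naturality {V U} g s := by
    obtain ⟨s, hs, rfl⟩ := F.exists_cls _ s
    refine congrArg (Submodule.Quotient.mk (p := ((F.pullback f le_rfl).vanishing V.obj).submoduleOf
      ((F.pullback f le_rfl).matching V.obj))) (Subtype.ext ?_)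
    funext W k
    exact (congrArg (s (push f le_rfl W)) ((Over.map f).map_comp k g.hom)).symm

/-- The identification `f^*ξ_H F = ξ_(f^*H) f^*F`; it reindexes families of sections. -/
noncomputable def sheafifyPullback (F : ModPresheaf.{u, v} H) :
    Equiv (F.sheafify.pullback f (K := ⊤) (by rw [Sieve.pullback_top]))
      (F.pullback f le_rfl).sheafify :=
  Equiv.ofBijective (sheafifyPullbackHom f F) (fun U => by
    constructor
    · rw [← LinearMap.ker_eq_bot, LinearMap.ker_eq_bot']
      intro s hs
      obtain ⟨s, hs', rfl⟩ := F.exists_cls _ s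
      exact (F.cls_eq_zero hs').2 (mem_vanishing_of_famPullback f F U.obj hs'
        (((F.pullback f le_rfl).cls_eq_zero (famPullback_mem_matching f F U.obj hs')).1 hs))
    · intro t
      obtain ⟨t, ht, rfl⟩ := (F.pullback f le_rfl).exists_cls U t
      obtain ⟨s, hs, h⟩ := exists_famPullback f F U.obj ht
      exact ⟨F.cls (push f (by rw [Sieve.pullback_top]) U) s hs,
        ((F.pullback f le_rfl).cls_eq_cls (famPullback_mem_matching f F U.obj hs) ht).2 h⟩)

end Comparison

end ModPresheaf

namespace StdVB

/-- The pullback `(f^*H, f^*E)` of a standard vector bundle. -/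
def pullbackObj (E : StdVB X) : StdVB Y where
  sieve := E.sieve.pullback f
  covering := Scheme.zariskiTopology.pullback_stable f E.covering
  presheaf :=
    { rank := fun U => E.presheaf.rank (push f le_rfl U)
      res := fun g => E.presheaf.res (pushMap f le_rfl g)
      res_id := fun U s => (E.mod.pullback f le_rfl).res_id U s
      res_comp := fun h g s => (E.mod.pullback f le_rfl).res_comp h g s }
  standard := fun U V g => E.standard (push f le_rfl U) (push f le_rfl V) (pushMap f le_rfl g)

/-- The identification of `f^*ξ_H E` with the sheaf associated to `f^*E`. -/
noncomputable def pullbackComparison (E : StdVB X) :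
    ModPresheaf.Equiv (E.sheaf.pullback f (K := ⊤) (by rw [Sieve.pullback_top]))
      (E.pullbackObj f).sheaf :=
  ModPresheaf.sheafifyPullback f E.mod

/-- The pullback functor on standard vector bundles. On morphisms it is the pullback of morphisms of
sheaves, under the identification `f^*ξ_H E = ξ_(f^*H) f^*E`. -/
noncomputable def pullback : StdVB X ⥤ StdVB Y where
  obj E := E.pullbackObj f
  map {E F} α := ((E.pullbackComparison f).symm.toHom.comp (ModPresheaf.Hom.pullback f α _)).comp
    (F.pullbackComparison f).toHom
  map_id E := (E.pullbackComparison f).symm_comp_toHom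
  map_comp {E F G} α β := by
    refine ModPresheaf.Hom.ext (funext fun U => LinearMap.ext fun s => ?_)
    exact congrArg (fun t => (G.pullbackComparison f).app U (β.app (push f _ U) t))
      (((F.pullbackComparison f).app U).symm_apply_apply _).symm

end StdVB

end Pullback

end StdBundle

/-!
A standard vector bundle is a system of matrices: its `H`-presheaf has standard free modules as values,
so it is determined by its sieve, its ranks and the matrices of its restriction maps (`ext_resCoef`).
Morphisms are also determined by matrices. Although they are defined as morphisms between the associated
sheaves, a standard presheaf is already a sheaf, so over an object `U` of both sieves a morphism
`ξE ⟶ ξF` is a linear map `E(U) ⟶ F(U)` (`locMap`); the intersection of the sieves is a covering sieve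
and the sheafifications are separated, so these maps determine the morphism (`hom_ext_locMap`).

In these terms the tensor product is the Kronecker product of matrices, for restriction maps by
definition (`resCoef_tensor`) and for morphisms because the canonical isomorphism `ζ` is compatible with
the units of sheafification (`zeta_toSh_kron`, `homCoef_tensor`). The theorem is then a property of the
Kronecker product: numbering pairs lexicographically is strictly associative, the `1 × 1` identity matrix
is a strict unit, and a `1 × 1` matrix commutes with every matrix. Pullback along `f` evaluates the same
matrices at schemes over `X` that come from schemes over `Y` (`homCoef_pullback`).

Matrix entries are indexed by natural numbers (`coef`), so that matrices of different bundles can be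
compared before the bundles are known to be equal; equality of functors is then equality of objects and
heterogeneous equality of morphisms.
-/

namespace StdBundle

/-! ### Matrices of semilinear maps -/

open TensorProduct ModPresheaf

section Matrices

variable {A B : Type u} [CommRing A] [CommRing B] {σ : A →+* B}

/-- The `(i, j)` entry of the matrix of a semilinear map between standard free modules. The indices are
natural numbers, with value `0` out of range, so that entries can be compared between modules whose
ranks are equal without being syntactically the same. -/
def coef {m n : ℕ} (φ : (Fin m → A) →ₛₗ[σ] (Fin n → B)) (i j : ℕ) : B :=
  if h : i < n ∧ j < m then φ (Pi.single ⟨j, h.2⟩ 1) ⟨i, h.1⟩ else 0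

lemma coef_val {m n : ℕ} (φ : (Fin m → A) →ₛₗ[σ] (Fin n → B)) (i : Fin n) (j : Fin m) :
    coef φ i j = φ (Pi.single j 1) i :=
  dif_pos ⟨i.2, j.2⟩

lemma coef_of_not_lt {m n : ℕ} (φ : (Fin m → A) →ₛₗ[σ] (Fin n → B)) {i j : ℕ} (h : ¬ (i < n ∧ j < m)) :
    coef φ i j = 0 :=
  dif_neg h

lemma semilinear_ext {m n : ℕ} {φ ψ : (Fin m → A) →ₛₗ[σ] (Fin n → B)}
    (h : ∀ i < n, ∀ j < m, coef φ i j = coef ψ i j) : φ = ψ := by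
  refine (Pi.basisFun A (Fin m)).ext fun j => funext fun i => ?_
  have := h i i.2 j j.2
  rwa [coef_val, coef_val, ← Pi.basisFun_apply] at this

/-- The matrix of a tensor product in the lexicographic basis is the Kronecker product. The formula
needs no bounds on `i` and `j`: out of range, one of the factors is out of range as well. -/
lemma coef_kron {m n m' n' : ℕ} (φ : (Fin m → A) →ₛₗ[σ] (Fin n → B))
    (ψ : (Fin m' → A) →ₛₗ[σ] (Fin n' → B)) (θ : (Fin (m * m') → A) →ₛₗ[σ] (Fin (n * n') → B))
    (hθ : ∀ s, θ s = kron B n n' (TensorProduct.map φ ψ ((kron A m m').symm s))) (i j : ℕ) :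
    coef θ i j = coef φ (i / n') (j / m') * coef ψ (i % n') (j % m') := by
  by_cases hi : i < n * n'
  · by_cases hj : j < m * m'
    · obtain ⟨⟨a, b⟩, hab⟩ := finProdFinEquiv.surjective (⟨i, hi⟩ : Fin (n * n'))
      obtain ⟨⟨c, d⟩, hcd⟩ := finProdFinEquiv.surjective (⟨j, hj⟩ : Fin (m * m'))
      have h1 := congrArg finProdFinEquiv.symm hab
      have h2 := congrArg finProdFinEquiv.symm hcd
      rw [Equiv.symm_apply_apply] at h1 h2
      have ea : (a : ℕ) = i / n' := congrArg (fun p => (p.1 : ℕ)) h1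
      have eb : (b : ℕ) = i % n' := congrArg (fun p => (p.2 : ℕ)) h1
      have ec : (c : ℕ) = j / m' := congrArg (fun p => (p.1 : ℕ)) h2
      have ed : (d : ℕ) = j % m' := congrArg (fun p => (p.2 : ℕ)) h2
      rw [← ea, ← eb, ← ec, ← ed, coef_val, coef_val]
      refine (coef_val θ ⟨i, hi⟩ ⟨j, hj⟩).trans ?_
      rw [hθ, ← hab, ← hcd, kron_symm_single, TensorProduct.map_tmul, kron_tmul]
    · rw [coef_of_not_lt _ (fun h => hj h.2)]
      -- for `m' = 0`, where `j % 0 = j`, it is the second factor that is out of range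
      rcases Nat.eq_zero_or_pos m' with rfl | hm
      · rw [coef_of_not_lt ψ (fun h => by simpa using h.2), mul_zero]
      · rw [coef_of_not_lt φ (fun h => hj ((Nat.div_lt_iff_lt_mul hm).1 h.2)), zero_mul]
  · rw [coef_of_not_lt _ (fun h => hi h.1)]
    rcases Nat.eq_zero_or_pos n' with rfl | hm
    · rw [coef_of_not_lt ψ (fun h => by simpa using h.1), mul_zero]
    · rw [coef_of_not_lt φ (fun h => hi ((Nat.div_lt_iff_lt_mul hm).1 h.1)), zero_mul]

end Matrices

/-! ### The unit of sheafification -/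

variable {X : Scheme.{u}}

namespace ModPresheaf

variable {H : Sieve X}

/-- `U` as an object of the whole big site. -/
def topObj (U : Over X) : Dom (⊤ : Sieve X) := ⟨U, trivial⟩

/-- The section of the sheafification defined by a section of the presheaf. It is the unit `F ⟶ ξF`,
with values stated over the whole big site. -/
def toSh (F : ModPresheaf.{u, v} H) (U : Dom H) (s : F.obj U) : F.sheafify.obj (topObj U.obj) :=
  F.cls (topObj U.obj) (F.unitFam U s) (F.unitFam_mem_matching U s)

lemma toSh_add (F : ModPresheaf.{u, v} H) (U : Dom H) (s t : F.obj U) :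
    F.toSh U (s + t) = F.toSh U s + F.toSh U t :=
  map_add (F.unitApp U) s t

lemma toSh_smul (F : ModPresheaf.{u, v} H) (U : Dom H) (r : O U.obj) (s : F.obj U) :
    F.toSh U (r • s) = HSMul.hSMul (α := O (topObj U.obj).obj) r (F.toSh U s) :=
  map_smul (F.unitApp U) r s

lemma toSh_injective {F : ModPresheaf.{u, v} H} (hF : F.IsSheaf) (U : Dom H) :
    Function.Injective (F.toSh U) :=
  ((F.unitEquiv hF).app U).injective

lemma sheafifyMap_toSh {F : ModPresheaf.{u, v} H} {G : ModPresheaf.{u, w} H} (γ : Hom F G)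
    (U : Dom H) (s : F.obj U) :
    (sheafifyMap γ).app (topObj U.obj) (F.toSh U s) = G.toSh U (γ.app U s) := by
  refine congrArg (Submodule.Quotient.mk (p := (G.vanishing U.obj).submoduleOf
    (G.matching U.obj))) (Subtype.ext ?_)
  funext W k
  exact γ.naturality _ s

lemma sheafifyRestrict_symm_toSh {K : Sieve X} (F : ModPresheaf.{u, v} H) (h : K ≤ H)
    (hK : K ∈ Scheme.zariskiTopology X) (U : Dom K) (s : F.obj (incl h U)) :
    (F.sheafifyRestrict h hK).symm.app (topObj U.obj) ((F.restrict h).toSh U s) =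
      F.toSh (incl h U) s :=
  (LinearEquiv.symm_apply_eq _).2 rfl

lemma sheafifyEquiv_trans_toSh {K : Sieve X} {F : ModPresheaf.{u, v} K} {G : ModPresheaf.{u, w} K}
    {L : ModPresheaf.{u, x} H} (h : K ≤ H) (hK : K ∈ Scheme.zariskiTopology X) (e₁ : Equiv F G)
    (e₂ : Equiv G (L.restrict h)) (U : Dom K) (s : F.obj U) :
    (((sheafifyEquiv e₁).trans (sheafifyEquiv e₂)).trans (L.sheafifyRestrict h hK).symm).app
      (topObj U.obj) (F.toSh U s) = L.toSh (incl h U) (e₂.app U (e₁.app U s)) := by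
  refine Eq.trans ?_ (L.sheafifyRestrict_symm_toSh h hK U _)
  refine congrArg ((L.sheafifyRestrict h hK).symm.app (topObj U.obj)) ?_
  exact (congrArg ((sheafifyMap e₂.toHom).app (topObj U.obj)) (sheafifyMap_toSh e₁.toHom U s)).trans
    (sheafifyMap_toSh e₂.toHom U _)

/-- A section of the sheafification comes locally from the presheaf. -/
lemma res_cls (F : ModPresheaf.{u, v} H) {U : Over X} (s : F.Fam U) (hs : s ∈ F.matching U) :
    ∃ S : Sieve U.left, S ∈ Scheme.zariskiTopology U.left ∧
      ∀ (V : Dom H) (k : V.obj ⟶ U), S k.left →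
        F.sheafify.res (V := topObj V.obj) (U := topObj U) (ObjectProperty.homMk k)
          (F.cls (topObj U) s hs) = F.toSh V (s V k) := by
  obtain ⟨S, hS, h⟩ := id hs
  refine ⟨S, hS, fun V k hk => (F.cls_eq_cls (U := topObj V.obj)
    (F.famRes_mem_matching k hs) (F.unitFam_mem_matching V _)).2
    ⟨⊤, Scheme.zariskiTopology.top_mem _, fun W g _ => ?_⟩⟩
  exact h V k hk W (ObjectProperty.homMk g)

/-- Sections of the sheafification of an `H`-sheaf that agree over the objects of the category of `H` in
a covering are equal. -/
lemma eq_of_res_eq {F : ModPresheaf.{u, v} H} (hF : F.IsSheaf) {U : Over X}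
    {x y : F.sheafify.obj (topObj U)}
    (h : ∃ S : Sieve U.left, S ∈ Scheme.zariskiTopology U.left ∧
      ∀ (V : Dom H) (k : V.obj ⟶ U), S k.left →
        F.sheafify.res (V := topObj V.obj) (U := topObj U) (ObjectProperty.homMk k) x =
        F.sheafify.res (V := topObj V.obj) (U := topObj U) (ObjectProperty.homMk k) y) :
    x = y := by
  rw [← sub_eq_zero]
  obtain ⟨S, hS, h⟩ := h
  obtain ⟨s, hs, e⟩ := F.exists_cls (topObj U) (x - y)
  obtain ⟨T, hT, ht⟩ := F.res_cls (U := U) s hs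
  rw [← e, F.cls_eq_zero]
  refine ⟨S ⊓ T, Scheme.zariskiTopology.intersection_covering hS hT, fun V k hk => ?_⟩
  have h1 := ht V k hk.2
  rw [e, map_sub, h V k hk.1, sub_self] at h1
  have h2 : s V k = 0 := toSh_injective hF V (h1.symm.trans
    (map_zero ((F.unitEquiv hF).app V)).symm)
  rw [h2]
  exact zero_mem _

end ModPresheaf

namespace StdVB

/-! ### Local matrices of morphisms -/

/-- The map `E(U) ⟶ F(U)` of standard free modules induced by a morphism `ξE ⟶ ξF`, for `U` in both
sieves; there `E(U) = (ξE)(U)` and `F(U) = (ξF)(U)`, because `E` and `F` are sheaves. -/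
noncomputable def locMap {E F : StdVB X} (γ : E ⟶ F) (U : Over X) (hE : E.sieve U.hom)
    (hF : F.sieve U.hom) :
    (Fin (E.presheaf.rank ⟨U, hE⟩) → O U) →ₗ[O U] (Fin (F.presheaf.rank ⟨U, hF⟩) → O U) :=
  have h : ∀ s : Fin (E.presheaf.rank ⟨U, hE⟩) → O U, ∃ t, F.mod.toSh ⟨U, hF⟩ t =
      ModPresheaf.Hom.app γ (topObj U) (E.mod.toSh ⟨U, hE⟩ s) := fun s =>
    ((F.mod.unitEquiv F.standard.isSheaf).app ⟨U, hF⟩).surjective _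
  -- the section `t` is unique, as the unit is injective; this makes its choice linear
  { toFun := fun s => (h s).choose
    map_add' := fun s t => toSh_injective F.standard.isSheaf ⟨U, hF⟩ (by
      rw [(h _).choose_spec, toSh_add, toSh_add, map_add, (h _).choose_spec, (h _).choose_spec])
    map_smul' := fun r s => toSh_injective F.standard.isSheaf ⟨U, hF⟩ (by
      refine (h _).choose_spec.trans ((congrArg _ (E.mod.toSh_smul ⟨U, hE⟩ r s)).trans ?_)
      refine (map_smul (ModPresheaf.Hom.app γ (topObj U)) _ _).trans (Eq.trans ?_
        (F.mod.toSh_smul ⟨U, hF⟩ r _).symm)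
      rw [(h _).choose_spec]) }

lemma toSh_locMap {E F : StdVB X} (γ : E ⟶ F) (U : Over X) (hE : E.sieve U.hom)
    (hF : F.sieve U.hom) (s : Fin (E.presheaf.rank ⟨U, hE⟩) → O U) :
    F.mod.toSh ⟨U, hF⟩ (locMap γ U hE hF s) = ModPresheaf.Hom.app γ (topObj U)
      (E.mod.toSh ⟨U, hE⟩ s) :=
  (((F.mod.unitEquiv F.standard.isSheaf).app ⟨U, hF⟩).surjective
    (ModPresheaf.Hom.app γ (topObj U) (E.mod.toSh ⟨U, hE⟩ s))).choose_spec

lemma locMap_eq {E F : StdVB X} {γ : E ⟶ F} {U : Over X} {hE : E.sieve U.hom}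
    {hF : F.sieve U.hom} {s : Fin (E.presheaf.rank ⟨U, hE⟩) → O U}
    {t : Fin (F.presheaf.rank ⟨U, hF⟩) → O U}
    (h : ModPresheaf.Hom.app γ (topObj U) (E.mod.toSh ⟨U, hE⟩ s) = F.mod.toSh ⟨U, hF⟩ t) :
    locMap γ U hE hF s = t :=
  toSh_injective F.standard.isSheaf _ ((toSh_locMap γ U hE hF s).trans h)

/-- A morphism is determined by its local maps: the two sieves have a common refinement, on which every
section of `ξE` comes locally from `E`. -/
lemma hom_ext_locMap {E F : StdVB X} {γ γ' : E ⟶ F}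
    (h : ∀ U hE hF, locMap γ U hE hF = locMap γ' U hE hF) : γ = γ' := by
  refine ModPresheaf.Hom.ext (funext fun U => LinearMap.ext fun x => ?_)
  obtain ⟨s, hs, rfl⟩ := E.mod.exists_cls U x
  obtain ⟨S, hS, hS'⟩ := E.mod.res_cls s hs
  refine eq_of_res_eq (U := U.obj) F.standard.isSheaf
    ⟨S ⊓ E.sieve.pullback U.obj.hom, Scheme.zariskiTopology.intersection_covering hS
    (Scheme.zariskiTopology.pullback_stable _ E.covering), fun V k hk => ?_⟩
  have hV : E.sieve V.obj.hom := by rw [← Over.w k]; exact hk.2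
  have h1 := hS' ⟨V.obj, hV⟩ k hk.1
  have h2 := γ.naturality (V := topObj V.obj) (U := U) (ObjectProperty.homMk k)
    (E.mod.cls (topObj U.obj) s hs)
  have h3 := γ'.naturality (V := topObj V.obj) (U := U) (ObjectProperty.homMk k)
    (E.mod.cls (topObj U.obj) s hs)
  refine h2.symm.trans (Eq.trans ?_ h3)
  refine (congrArg (ModPresheaf.Hom.app γ (topObj V.obj)) h1).trans (Eq.trans ?_
    (congrArg (ModPresheaf.Hom.app γ' (topObj V.obj)) h1).symm)
  rw [← toSh_locMap γ V.obj hV V.property, ← toSh_locMap γ' V.obj hV V.property, h]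

/-! ### Local matrices of tensor products and pullbacks -/

/-- The isomorphism `E ⊗ᵖ F ≅ ξE ⊗ᵖ ξF` over the intersection of the two sieves. -/
noncomputable def unitTensorEquiv (E F : StdVB X) :
    Equiv (E.tensorMod F) ((E.sheaf.tensor F.sheaf).restrict le_top) :=
  tensorEquiv ((E.mod.unitEquiv E.standard.isSheaf).restrict inf_le_left)
    ((F.mod.unitEquiv F.standard.isSheaf).restrict inf_le_right)

/-- The isomorphism from the tensor product of standard vector bundles to the presheaf tensor product,
given by the inverses of `kron`. -/
noncomputable def kronEquiv (E F : StdVB X) : Equiv (E.tensorObj F).mod (E.tensorMod F) :=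
  StdPresheaf.standardizeEquiv _ _ _

/-- The definition of `ζ` with its two local isomorphisms named: with their values in place, comparing
terms that contain them becomes expensive. -/
lemma zeta_eq (E F : StdVB X) : E.zeta F =
    ((sheafifyEquiv (kronEquiv E F)).trans (sheafifyEquiv (unitTensorEquiv E F))).trans
      ((E.sheaf.tensor F.sheaf).sheafifyRestrict le_top (E.tensorObj F).covering).symm :=
  rfl

lemma unitTensorEquiv_kronEquiv (E F : StdVB X) (U : Over X) (hE : E.sieve U.hom)
    (hF : F.sieve U.hom) (a : Fin (E.presheaf.rank ⟨U, hE⟩) → O U)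
    (b : Fin (F.presheaf.rank ⟨U, hF⟩) → O U) :
    (unitTensorEquiv E F).app ⟨U, hE, hF⟩
        ((kronEquiv E F).app ⟨U, hE, hF⟩ (kron (O U) _ _ (a ⊗ₜ b))) =
      E.mod.toSh ⟨U, hE⟩ a ⊗ₜ[O (topObj U).obj] F.mod.toSh ⟨U, hF⟩ b :=
  congrArg ((unitTensorEquiv E F).app ⟨U, hE, hF⟩) ((kron (O U) _ _).symm_apply_apply (a ⊗ₜ b))

lemma zeta_toSh (E F : StdVB X) (W : Dom (E.sieve ⊓ F.sieve)) (s : (E.tensorObj F).mod.obj W) :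
    (E.zeta F).app (topObj W.obj) ((E.tensorObj F).mod.toSh W s) =
      (E.sheaf.tensor F.sheaf).toSh (topObj W.obj)
        ((unitTensorEquiv E F).app W ((kronEquiv E F).app W s)) := by
  rw [zeta_eq]
  exact (sheafifyEquiv_trans_toSh _ _ _ _ W s)

/-- The canonical isomorphism `ζ` sends `a ⊗ b`, in the Kronecker coordinates, to the class of
`a ⊗ b`. -/
lemma zeta_toSh_kron (E F : StdVB X) (U : Over X) (hE : E.sieve U.hom) (hF : F.sieve U.hom)
    (a : Fin (E.presheaf.rank ⟨U, hE⟩) → O U) (b : Fin (F.presheaf.rank ⟨U, hF⟩) → O U) :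
    (E.zeta F).app (topObj U) ((E.tensorObj F).mod.toSh ⟨U, hE, hF⟩ (kron (O U) _ _ (a ⊗ₜ b))) =
      (E.sheaf.tensor F.sheaf).toSh (topObj U)
        (E.mod.toSh ⟨U, hE⟩ a ⊗ₜ F.mod.toSh ⟨U, hF⟩ b) :=
  (zeta_toSh E F ⟨U, hE, hF⟩ _).trans (congrArg ((E.sheaf.tensor F.sheaf).toSh (topObj U))
    (unitTensorEquiv_kronEquiv E F U hE hF a b))

/-- On pure tensors, `γ ⊗ δ` is computed locally by `γ` and `δ`. -/
lemma locMap_tensorHom_kron {E E' F F' : StdVB X} (γ : E ⟶ E') (δ : F ⟶ F') (U : Over X)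
    (hE : E.sieve U.hom) (hE' : E'.sieve U.hom) (hF : F.sieve U.hom) (hF' : F'.sieve U.hom)
    (a : Fin (E.presheaf.rank ⟨U, hE⟩) → O U) (b : Fin (F.presheaf.rank ⟨U, hF⟩) → O U) :
    locMap (tensorHom γ δ) U ⟨hE, hF⟩ ⟨hE', hF'⟩ (kron (O U) _ _ (a ⊗ₜ b)) =
      kron (O U) _ _ (locMap γ U hE hE' a ⊗ₜ locMap δ U hF hF' b) := by
  refine locMap_eq ?_
  refine (LinearEquiv.symm_apply_eq ((E'.zeta F').app (topObj U))).2 ?_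
  refine Eq.trans ?_ (zeta_toSh_kron E' F' U hE' hF' _ _).symm
  rw [toSh_locMap, toSh_locMap]
  refine (congrArg _ (zeta_toSh_kron E F U hE hF a b)).trans ?_
  exact sheafifyMap_toSh (tensorMap γ δ) (topObj U) _

lemma locMap_tensorHom {E E' F F' : StdVB X} (γ : E ⟶ E') (δ : F ⟶ F') (U : Over X)
    (hE : E.sieve U.hom) (hE' : E'.sieve U.hom) (hF : F.sieve U.hom) (hF' : F'.sieve U.hom)
    (s : Fin (E.presheaf.rank ⟨U, hE⟩ * F.presheaf.rank ⟨U, hF⟩) → O U) :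
    locMap (tensorHom γ δ) U ⟨hE, hF⟩ ⟨hE', hF'⟩ s =
      kron (O U) _ _ (TensorProduct.map (locMap γ U hE hE') (locMap δ U hF hF')
        ((kron (O U) _ _).symm s)) := by
  obtain ⟨z, rfl⟩ := (kron (O U) _ _).surjective s
  rw [LinearEquiv.symm_apply_apply]
  induction z with
  | zero => simp only [map_zero]; exact map_zero _
  | add x y hx hy =>
    simp only [map_add]
    rw [← hx, ← hy]
    exact map_add _ _ _
  | tmul a b => exact locMap_tensorHom_kron γ δ U hE hE' hF hF' a b

lemma toSh_pullback {Y : Scheme.{u}} (f : Y ⟶ X) (E : StdVB X) (U : Over Y)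
    (hE : E.sieve ((Over.map f).obj U).hom)
    (s : Fin (E.presheaf.rank ⟨(Over.map f).obj U, hE⟩) → O U) :
    (E.pullbackComparison f).app (topObj U) (E.mod.toSh ⟨(Over.map f).obj U, hE⟩ s) =
      (E.pullbackObj f).mod.toSh ⟨U, hE⟩ s := rfl

lemma locMap_pullback {Y : Scheme.{u}} (f : Y ⟶ X) {E F : StdVB X} (γ : E ⟶ F) (U : Over Y)
    (hE : E.sieve ((Over.map f).obj U).hom) (hF : F.sieve ((Over.map f).obj U).hom)
    (s : Fin (E.presheaf.rank ⟨(Over.map f).obj U, hE⟩) → O U) :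
    locMap ((pullback f).map γ) U hE hF s = locMap γ ((Over.map f).obj U) hE hF s := by
  refine locMap_eq ?_
  refine Eq.trans ?_ (toSh_pullback f F U hF _)
  refine congrArg ((F.pullbackComparison f).app (topObj U)) ?_
  refine Eq.trans ?_ (toSh_locMap γ _ hE hF s).symm
  refine congrArg (ModPresheaf.Hom.app γ (topObj ((Over.map f).obj U))) ?_
  exact (LinearEquiv.symm_apply_eq ((E.pullbackComparison f).app (topObj U))).2
    (toSh_pullback f E U hE s).symm

/-! ### Equality of standard vector bundles and of their morphisms -/

/-- The entries of the matrices of the restriction maps of a standard vector bundle. -/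
def resCoef (E : StdVB X) {V U : Over X} (g : V ⟶ U) (hV : E.sieve V.hom) (hU : E.sieve U.hom)
    (i j : ℕ) : O V :=
  coef (E.presheaf.res (V := ⟨V, hV⟩) (U := ⟨U, hU⟩) (ObjectProperty.homMk g)) i j

/-- The entries of the local matrices of a morphism of standard vector bundles. -/
noncomputable def homCoef {E F : StdVB X} (γ : E ⟶ F) (U : Over X) (hE : E.sieve U.hom)
    (hF : F.sieve U.hom) (i j : ℕ) : O U :=
  coef (locMap γ U hE hF) i j

/-- Standard vector bundles with the same sieve, ranks and restriction matrices are equal. -/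
lemma ext_resCoef {E F : StdVB X} (h : E.sieve = F.sieve)
    (hr : ∀ U hE hF, E.presheaf.rank ⟨U, hE⟩ = F.presheaf.rank ⟨U, hF⟩)
    (hc : ∀ V U (g : V ⟶ U) hVE hUE hVF hUF, ∀ i < E.presheaf.rank ⟨V, hVE⟩,
      ∀ j < E.presheaf.rank ⟨U, hUE⟩, E.resCoef g hVE hUE i j = F.resCoef g hVF hUF i j) :
    E = F := by
  obtain ⟨H, cE, ⟨rE, resE, h1, h2⟩, sE⟩ := E
  obtain ⟨K, cF, ⟨rF, resF, h3, h4⟩, sF⟩ := F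
  obtain rfl : H = K := h
  obtain rfl : rE = rF := funext fun U => hr U.obj U.property U.property
  obtain rfl : @resE = @resF := by
    funext V U g
    exact semilinear_ext fun i hi j hj => hc V.obj U.obj g.hom _ _ _ _ i hi j hj
  rfl

/-- Morphisms between equal bundles are equal as soon as their local matrices are. -/
lemma hom_heq {E F E' F' : StdVB X} (hE : E = E') (hF : F = F') {γ : E ⟶ F} {γ' : E' ⟶ F'}
    (h : ∀ U hUE hUF hUE' hUF', ∀ i < F.presheaf.rank ⟨U, hUF⟩, ∀ j < E.presheaf.rank ⟨U, hUE⟩,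
      homCoef γ U hUE hUF i j = homCoef γ' U hUE' hUF' i j) : γ ≍ γ' := by
  subst hE hF
  exact heq_of_eq (hom_ext_locMap fun U hUE hUF => semilinear_ext fun i hi j hj =>
    h U hUE hUF hUE hUF i hi j hj)

lemma resCoef_tensor (E F : StdVB X) {V U : Over X} (g : V ⟶ U) (hVE : E.sieve V.hom)
    (hVF : F.sieve V.hom) (hUE : E.sieve U.hom) (hUF : F.sieve U.hom) (i j : ℕ) :
    (E.tensorObj F).resCoef g ⟨hVE, hVF⟩ ⟨hUE, hUF⟩ i j =
      E.resCoef g hVE hUE (i / F.presheaf.rank ⟨V, hVF⟩) (j / F.presheaf.rank ⟨U, hUF⟩) *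
      F.resCoef g hVF hUF (i % F.presheaf.rank ⟨V, hVF⟩) (j % F.presheaf.rank ⟨U, hUF⟩) :=
  coef_kron _ _ _ (fun _ => rfl) i j

lemma homCoef_tensor {E E' F F' : StdVB X} (γ : E ⟶ E') (δ : F ⟶ F') (U : Over X)
    (hE : E.sieve U.hom) (hE' : E'.sieve U.hom) (hF : F.sieve U.hom) (hF' : F'.sieve U.hom)
    (i j : ℕ) :
    homCoef (tensorHom γ δ) U ⟨hE, hF⟩ ⟨hE', hF'⟩ i j =
      homCoef γ U hE hE' (i / F'.presheaf.rank ⟨U, hF'⟩) (j / F.presheaf.rank ⟨U, hF⟩) *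
      homCoef δ U hF hF' (i % F'.presheaf.rank ⟨U, hF'⟩) (j % F.presheaf.rank ⟨U, hF⟩) :=
  coef_kron _ _ _ (locMap_tensorHom γ δ U hE hE' hF hF') i j

lemma homCoef_id (E : StdVB X) (U : Over X) (hE hE' : E.sieve U.hom) (i : ℕ)
    (hi : i < E.presheaf.rank ⟨U, hE⟩) : homCoef (𝟙 E) U hE hE' i i = 1 := by
  refine (coef_val _ ⟨i, hi⟩ ⟨i, hi⟩).trans ?_
  have : locMap (𝟙 E) U hE hE' (Pi.single ⟨i, hi⟩ 1) = Pi.single ⟨i, hi⟩ 1 := locMap_eq rfl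
  rw [this, Pi.single_eq_same]

lemma resCoef_trivial {V U : Over X} (g : V ⟶ U) (hV hU) :
    (trivial X 1).resCoef g hV hU 0 0 = 1 := by
  refine (coef_val _ (0 : Fin 1) (0 : Fin 1)).trans ?_
  exact map_one (resO g)

lemma homCoef_pullback {Y : Scheme.{u}} (f : Y ⟶ X) {E F : StdVB X} (γ : E ⟶ F) (U : Over Y)
    (hE : E.sieve ((Over.map f).obj U).hom) (hF : F.sieve ((Over.map f).obj U).hom) (i j : ℕ) :
    homCoef ((pullback f).map γ) U hE hF i j = homCoef γ ((Over.map f).obj U) hE hF i j :=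
  congrArg (coef · i j) (LinearMap.ext (locMap_pullback f γ U hE hF))

/-! ### Strictness of the tensor product -/

lemma tensor_map {p q : StdVB X × StdVB X} (f : p ⟶ q) :
    (tensor X).map f = tensorHom f.1 f.2 :=
  rfl

lemma rank_tensorObj_line (E : StdVB X) {L : StdVB X} (hL : IsLine L) (U : Over X)
    (h : (E.tensorObj L).sieve U.hom) :
    (E.tensorObj L).presheaf.rank ⟨U, h⟩ = E.presheaf.rank ⟨U, h.1⟩ :=
  (congrArg (E.presheaf.rank ⟨U, h.1⟩ * ·) (hL _)).trans (mul_one _)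

/-- The Kronecker product of matrices is associative on the nose. -/
lemma kron_assoc {A : Type u} [CommRing A] (a b c : ℕ → ℕ → A) (n n' p p' i j : ℕ) :
    a (i / p / n) (j / p' / n') * b (i / p % n) (j / p' % n') * c (i % p) (j % p') =
      a (i / (n * p)) (j / (n' * p')) * (b (i % (n * p) / p) (j % (n' * p') / p') *
        c (i % (n * p) % p) (j % (n' * p') % p')) := by
  rw [Nat.div_div_eq_div_mul, Nat.div_div_eq_div_mul, mul_comm n, mul_comm n',
    Nat.mod_mul_right_div_self, Nat.mod_mul_right_div_self, Nat.mod_mul_right_mod,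
    Nat.mod_mul_right_mod, mul_assoc]

lemma tensorObj_assoc (E F G : StdVB X) :
    (E.tensorObj F).tensorObj G = E.tensorObj (F.tensorObj G) := by
  refine ext_resCoef (inf_assoc _ _ _) (fun U h h' => mul_assoc _ _ _) ?_
  rintro V U g ⟨⟨hVE, hVF⟩, hVG⟩ ⟨⟨hUE, hUF⟩, hUG⟩ - - i - j -
  refine (resCoef_tensor (E.tensorObj F) G g ⟨hVE, hVF⟩ hVG ⟨hUE, hUF⟩ hUG i j).trans ?_
  refine Eq.trans ?_ (resCoef_tensor E (F.tensorObj G) g hVE ⟨hVF, hVG⟩ hUE ⟨hUF, hUG⟩ i j).symm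
  rw [resCoef_tensor E F g hVE hVF hUE hUF, resCoef_tensor F G g hVF hVG hUF hUG]
  exact kron_assoc _ _ _ _ _ _ _ i j

lemma tensorHom_assoc {E E' F F' G G' : StdVB X} (γ : E ⟶ E') (δ : F ⟶ F') (ε : G ⟶ G') :
    tensorHom (tensorHom γ δ) ε ≍ tensorHom γ (tensorHom δ ε) := by
  refine hom_heq (tensorObj_assoc _ _ _) (tensorObj_assoc _ _ _) ?_
  rintro U ⟨⟨hE, hF⟩, hG⟩ ⟨⟨hE', hF'⟩, hG'⟩ - - i - j -
  refine (homCoef_tensor (tensorHom γ δ) ε U ⟨hE, hF⟩ ⟨hE', hF'⟩ hG hG' i j).trans ?_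
  refine Eq.trans ?_ (homCoef_tensor γ (tensorHom δ ε) U hE hE' ⟨hF, hG⟩ ⟨hF', hG'⟩ i j).symm
  rw [homCoef_tensor γ δ U hE hE' hF hF', homCoef_tensor δ ε U hF hF' hG hG']
  exact kron_assoc _ _ _ _ _ _ _ i j

lemma trivial_tensorObj (E : StdVB X) : (trivial X 1).tensorObj E = E := by
  refine ext_resCoef (top_inf_eq E.sieve) (fun U h h' => one_mul _) ?_
  rintro V U g ⟨hV', hV⟩ ⟨hU', hU⟩ - - i hi j hj
  replace hi : i < E.presheaf.rank ⟨V, hV⟩ := hi.trans_eq (one_mul _)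
  replace hj : j < E.presheaf.rank ⟨U, hU⟩ := hj.trans_eq (one_mul _)
  refine (resCoef_tensor _ E g hV' hV hU' hU i j).trans ?_
  rw [Nat.div_eq_of_lt hi, Nat.div_eq_of_lt hj, Nat.mod_eq_of_lt hi, Nat.mod_eq_of_lt hj,
    resCoef_trivial, one_mul]

lemma trivial_tensorHom {E F : StdVB X} (γ : E ⟶ F) : tensorHom (𝟙 (trivial X 1)) γ ≍ γ := by
  refine hom_heq (trivial_tensorObj _) (trivial_tensorObj _) ?_
  rintro U ⟨hE', hE⟩ ⟨hF', hF⟩ - - i hi j hj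
  replace hi : i < F.presheaf.rank ⟨U, hF⟩ := hi.trans_eq (one_mul _)
  replace hj : j < E.presheaf.rank ⟨U, hE⟩ := hj.trans_eq (one_mul _)
  refine (homCoef_tensor _ γ U hE' hF' hE hF i j).trans ?_
  rw [Nat.div_eq_of_lt hi, Nat.div_eq_of_lt hj, Nat.mod_eq_of_lt hi, Nat.mod_eq_of_lt hj,
    homCoef_id _ _ _ _ _ Nat.one_pos, one_mul]

/-- In `E ⊗ L` the row index `i` splits as `(i, 0)`, and in `L ⊗ E` as `(0, i)`; so both restriction
maps have the entries of `E` multiplied by the single entry of `L`. -/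
lemma tensorObj_line_comm (E : StdVB X) {L : StdVB X} (hL : IsLine L) :
    E.tensorObj L = L.tensorObj E := by
  refine ext_resCoef (inf_comm _ _) (fun U h h' => mul_comm _ _) ?_
  rintro V U g ⟨hVE, hVL⟩ ⟨hUE, hUL⟩ - - i hi j hj
  replace hi : i < E.presheaf.rank ⟨V, hVE⟩ := hi.trans_eq (rank_tensorObj_line _ hL _ _)
  replace hj : j < E.presheaf.rank ⟨U, hUE⟩ := hj.trans_eq (rank_tensorObj_line _ hL _ _)
  refine (resCoef_tensor E L g hVE hVL hUE hUL i j).trans ?_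
  refine Eq.trans ?_ (resCoef_tensor L E g hVL hVE hUL hUE i j).symm
  rw [Nat.div_eq_of_lt hi, Nat.div_eq_of_lt hj, Nat.mod_eq_of_lt hi, Nat.mod_eq_of_lt hj,
    hL, hL, Nat.div_one, Nat.div_one, Nat.mod_one, Nat.mod_one, mul_comm]

lemma tensorHom_line_comm {E E' L L' : StdVB X} (hL : IsLine L) (hL' : IsLine L') (γ : E ⟶ E')
    (β : L ⟶ L') : tensorHom γ β ≍ tensorHom β γ := by
  refine hom_heq (tensorObj_line_comm _ hL) (tensorObj_line_comm _ hL') ?_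
  rintro U ⟨hE, hF⟩ ⟨hE', hF'⟩ - - i hi j hj
  replace hi : i < E'.presheaf.rank ⟨U, hE'⟩ := hi.trans_eq (rank_tensorObj_line _ hL' _ _)
  replace hj : j < E.presheaf.rank ⟨U, hE⟩ := hj.trans_eq (rank_tensorObj_line _ hL _ _)
  refine (homCoef_tensor γ β U hE hE' hF hF' i j).trans ?_
  refine Eq.trans ?_ (homCoef_tensor β γ U hF hF' hE hE' i j).symm
  rw [Nat.div_eq_of_lt hi, Nat.div_eq_of_lt hj, Nat.mod_eq_of_lt hi, Nat.mod_eq_of_lt hj,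
    hL, hL', Nat.div_one, Nat.div_one, Nat.mod_one, Nat.mod_one, mul_comm]

lemma isLine_trivial : IsLine (trivial X 1) := fun _ => rfl

lemma tensorObj_trivial (E : StdVB X) : E.tensorObj (trivial X 1) = E :=
  (tensorObj_line_comm E isLine_trivial).trans (trivial_tensorObj E)

lemma tensorHom_trivial {E F : StdVB X} (γ : E ⟶ F) : tensorHom γ (𝟙 (trivial X 1)) ≍ γ :=
  (tensorHom_line_comm isLine_trivial isLine_trivial γ (𝟙 _)).trans (trivial_tensorHom γ)

/-! ### Pullback -/

lemma pullbackObj_trivial {Y : Scheme.{u}} (f : Y ⟶ X) (n : ℕ) :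
    (trivial X n).pullbackObj f = trivial Y n :=
  ext_resCoef Sieve.pullback_top (fun _ _ _ => rfl) fun _ _ _ _ _ _ _ _ _ _ _ => rfl

lemma pullbackObj_tensorObj {Y : Scheme.{u}} (f : Y ⟶ X) (E F : StdVB X) :
    (E.tensorObj F).pullbackObj f = (E.pullbackObj f).tensorObj (F.pullbackObj f) :=
  ext_resCoef (Sieve.pullback_inter _ _) (fun _ _ _ => rfl)
    fun _ _ g ⟨hVE, hVF⟩ ⟨hUE, hUF⟩ _ _ i _ j _ =>
      (resCoef_tensor E F ((Over.map f).map g) hVE hVF hUE hUF i j).trans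
        (resCoef_tensor (E.pullbackObj f) (F.pullbackObj f) g hVE hVF hUE hUF i j).symm

lemma pullback_tensorHom {Y : Scheme.{u}} (f : Y ⟶ X) {E E' F F' : StdVB X} (γ : E ⟶ E')
    (δ : F ⟶ F') : (pullback f).map (tensorHom γ δ) ≍
      tensorHom ((pullback f).map γ) ((pullback f).map δ) := by
  refine hom_heq (pullbackObj_tensorObj f E F) (pullbackObj_tensorObj f E' F') ?_
  rintro U ⟨hE, hF⟩ ⟨hE', hF'⟩ - - i - j -
  refine (homCoef_pullback f (tensorHom γ δ) U ⟨hE, hF⟩ ⟨hE', hF'⟩ i j).trans ?_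
  refine (homCoef_tensor γ δ _ hE hE' hF hF' i j).trans (Eq.trans ?_
    (homCoef_tensor ((pullback f).map γ) ((pullback f).map δ) U hE hE' hF hF' i j).symm)
  exact (congrArg₂ (· * ·) (homCoef_pullback f γ U hE hE' _ _)
    (homCoef_pullback f δ U hF hF' _ _)).symm

end StdVB
end StdBundle

theorem theorem3p6 (X : AlgebraicGeometry.Scheme.{u}) :
    -- the tensor product is strictly associative
    ((StdBundle.StdVB.tensor X).prod (𝟭 (StdBundle.StdVB X)) ⋙ StdBundle.StdVB.tensor X =
      CategoryTheory.prod.associator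
          (StdBundle.StdVB X) (StdBundle.StdVB X) (StdBundle.StdVB X) ⋙
        (𝟭 (StdBundle.StdVB X)).prod (StdBundle.StdVB.tensor X) ⋙ StdBundle.StdVB.tensor X) ∧
    -- the trivial line bundle is a strict unit on both sides
    (CategoryTheory.Prod.sectR (StdBundle.StdVB.trivial X 1) (StdBundle.StdVB X) ⋙
        StdBundle.StdVB.tensor X = 𝟭 (StdBundle.StdVB X) ∧
      CategoryTheory.Prod.sectL (StdBundle.StdVB X) (StdBundle.StdVB.trivial X 1) ⋙
        StdBundle.StdVB.tensor X = 𝟭 (StdBundle.StdVB X)) ∧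
    -- standard line bundles are a strict center, on objects and on morphisms
    ((𝟭 (StdBundle.StdVB X)).prod (StdBundle.StdVB.IsLine (X := X)).ι ⋙
        StdBundle.StdVB.tensor X =
      CategoryTheory.Prod.swap (StdBundle.StdVB X) (StdBundle.StdVB.LineBundle X) ⋙
        (StdBundle.StdVB.IsLine (X := X)).ι.prod (𝟭 (StdBundle.StdVB X)) ⋙
        StdBundle.StdVB.tensor X) ∧
    -- pullback strictly preserves the unit and the tensor product
    ∀ (Y : AlgebraicGeometry.Scheme.{u}) (f : Y ⟶ X),
      (StdBundle.StdVB.pullback f).obj (StdBundle.StdVB.trivial X 1) =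
        StdBundle.StdVB.trivial Y 1 ∧
      StdBundle.StdVB.tensor X ⋙ StdBundle.StdVB.pullback f =
        (StdBundle.StdVB.pullback f).prod (StdBundle.StdVB.pullback f) ⋙
          StdBundle.StdVB.tensor Y := by
  open StdBundle StdVB in
  refine ⟨Functor.hext (fun p => ?_) (fun p q f => ?_),
    ⟨Functor.hext (fun E => ?_) (fun E F γ => ?_), Functor.hext (fun E => ?_) (fun E F γ => ?_)⟩,
    Functor.hext (fun p => ?_) (fun p q f => ?_),
    fun Y f => ⟨pullbackObj_trivial f 1, Functor.hext (fun p => ?_) (fun p q g => ?_)⟩⟩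
  · exact tensorObj_assoc p.1.1 p.1.2 p.2
  · dsimp only [Functor.comp_map, Functor.prod_map, prod.associator_map, tensor_map, Functor.id_map]
    exact tensorHom_assoc f.1.1 f.1.2 f.2
  · exact trivial_tensorObj E
  · dsimp only [Functor.comp_map, Functor.id_map, tensor_map, Prod.sectR_map]
    exact trivial_tensorHom γ
  · exact tensorObj_trivial E
  · dsimp only [Functor.comp_map, Functor.id_map, tensor_map, Prod.sectL_map]
    exact tensorHom_trivial γ
  · exact tensorObj_line_comm p.1 p.2.property
  · dsimp only [Functor.comp_map, Functor.id_map, tensor_map, Functor.prod_map, Prod.swap_map,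
      ObjectProperty.ι_map]
    exact tensorHom_line_comm p.2.property q.2.property f.1 f.2.hom
  · exact pullbackObj_tensorObj f p.1 p.2
  · dsimp only [Functor.comp_map, Functor.id_map, tensor_map, Functor.prod_map]
    exact pullback_tensorHom f g.1 g.2
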